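/- Let $V$ be a real vector space of dimension $n$, let $\Phi_V=(\phi_1,\dots,\phi_l)\in\bigoplus_{i=1}^l\wedge^{p_i}V^*$, and let $\mathcal O$ be its $GL(V)$-orbit. Let $X$ be a compact smooth $n$-manifold and let $\Phi^0=(\phi^0_1,\dots,\phi^0_l)$ be a smooth tuple of closed differential forms on $X$ such that for every $x\in X$ some (equivalently, every) linear isomorphism $T_xX\cong V$ carries $\Phi^0(x)$ into $\mathcal O$. Let $\Gamma(E^2)$ be the space of smooth tuples $\Psi\in\Gamma(\bigoplus_i\wedge^{p_i+1}T^*X)$ such that, for all $x$, $\Psi(x)$ lies in the span $E^2(T_xX)$ of the elements $\alpha\wedge i_v\Phi^0(x)=(\alpha\wedge i_v\phi^0_i(x))_i$ with $\alpha\in\wedge^2T_x^*X$, $v\in T_xX$. For $a\in\mathrm{End}(TX)$ (a smooth field of endomorphisms) let $\hat\rho_a$ act on forms by $(\hat\rho_a\eta)(u_1,\dots,u_p)=\sum_i\eta(u_1,\dots,au_i,\dots,u_p)$; it is the differential of $\rho_g\eta=\eta(g\,\cdot,\dots,g\,\cdot)$. Put $L_a=[\hat\rho_a,d]$, and let $N(a,b)\in\wedge^2\otimes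 TX$ be the tensor $$N(a,b)(u,v)=ab[u,v]+ba[u,v]+[au,bv]-[av,bu]-a[bu,v]+a[bv,u]-b[au,v]+b[av,u].$$ For $N\in\wedge^2\otimes TX$ let $i_N$ be the operator on forms which is linear in $N$ and equals $\alpha\wedge i_v$ for $N=\alpha\otimes v$. All these notions are extended to formal power series in $t$ coefficientwise; $(\cdot)_k$ denotes the coefficient of $t^k$. For $a=a(t)\in\mathrm{End}(TX)[[t]]$ put $G(a,a)=i_{N(a,a)}-L_{a^2}$ and $\mathrm{Ad}_{\hat\rho_a}P=[\hat\rho_a,P]$. Let $a_1,a_2,\dots\in\mathrm{End}(TX)$, $a=a(t)=\sum_{j\ge1}\frac1{j!}a_jt^j$ and $a_{<k}=\sum_{1\le j<k}\frac1{j!}a_jt^j$. Let $R_k=(\rho_{\exp a(t)}\Phi^0)_k$ and $$Ob_k(a_{<k})=\sum_{m=2}^k\frac1{m!}\,d\,(\hat\rho_{a_{<k}}^m)_k\,\Phi^0 .$$ Let $k\ge1$ and suppose that $dR_j=0$ for all $1\le j<k$. Then $$dR_k=\frac1{k!}\,d\hat\rho_{a_k}\Phi^0+Ob_k(a_{<k}),$$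 $$Ob_k(a_{<k})=\sum_{m=2}^k\frac{(-1)^{m-1}}{m!}\bigl(\mathrm{Ad}_{\hat\rho_a}^{m-2}G(a,a)\bigr)_k\Phi^0=\bigl(f(\mathrm{Ad}_{\hat\rho_a})G(a,a)\bigr)_k\Phi^0,$$ where $f(x)=-\frac1{2!}+\frac1{3!}x-\frac1{4!}x^2+\cdots=-\frac{e^{-x}-1+x}{x^2}$, and the last expression does not change if $a$ is replaced by $a_{<k}$. Moreover $Ob_k(a_{<k})\in\Gamma(E^2)$, and $Ob_k(a_{<k})$ is $d$-exact, i.e. $Ob_k(a_{<k})=d\beta$ for a smooth tuple $\beta\in\Gamma(\bigoplus_i\wedge^{p_i}T^*X)$. -/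

import Mathlib

open scoped Manifold ContDiff Bundle
noncomputable section
namespace GaugeDef

section LinearAlgebra
variable {E : Type*} [NormedAddCommGroup E] [NormedSpace ℝ E]

/-- The differential `ρ̂_ξ` of the action `ρ_g φ = φ(g ·, …, g ·)` of `GL(E)` on `⋀^p E*`:
the derivative of `g ↦ ρ_g φ` at the identity in the direction `ξ`. -/
def infAction (ξ : E →L[ℝ] E) {p : ℕ} (φ : E [⋀^Fin p]→L[ℝ] ℝ) : E [⋀^Fin p]→L[ℝ] ℝ :=
  φ.fderivCompContinuousLinearMap (ContinuousLinearMap.id ℝ E) ξ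

theorem infAction_apply (ξ : E →L[ℝ] E) {p : ℕ} (φ : E [⋀^Fin p]→L[ℝ] ℝ) (u : Fin p → E) :
    infAction ξ φ u = ∑ i, φ (Function.update u i (ξ (u i))) := by
  rw [infAction, ContinuousAlternatingMap.fderivCompContinuousLinearMap_apply]
  refine Finset.sum_congr rfl fun i _ => congrArg φ (funext fun j => ?_)
  by_cases h : j = i
  · subst h; simp
  · simp [Function.update_of_ne h]

/-- The coefficient of `t^k` in `ρ_{g(t)} φ = φ(g(t) ·, …, g(t) ·)`, where `g(t) = ∑ g_j t^j`:
the value on `(u_1, …, u_p)` is the sum of `φ(g_{c_1} u_1, …, g_{c_p} u_p)` over all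
`c_1 + ⋯ + c_p = k`. -/
def pullbackCoeff (g : ℕ → E →L[ℝ] E) (k : ℕ) {p : ℕ} (φ : E [⋀^Fin p]→L[ℝ] ℝ) :
    E [⋀^Fin p]→L[ℝ] ℝ where
  toContinuousMultilinearMap := ∑ c ∈ Finset.piAntidiag Finset.univ k,
    φ.toContinuousMultilinearMap.compContinuousLinearMap fun i => g (c i)
  map_eq_zero_of_eq' := by
    intro v i j hv hij
    change (∑ c ∈ Finset.piAntidiag Finset.univ k,
      φ.toContinuousMultilinearMap.compContinuousLinearMap fun i => g (c i)) v = 0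
    rw [_root_.sum_apply]
    refine Finset.sum_involution (fun c _ => c ∘ Equiv.swap i j) ?_ ?_ ?_ ?_
    · intro c _
      have h : (fun l => g ((c ∘ Equiv.swap i j) l) (v l))
          = (fun l => g (c l) (v l)) ∘ Equiv.swap i j := by
        funext l
        have : v (Equiv.swap i j l) = v l := by
          rcases eq_or_ne l i with rfl | hi
          · simp [hv]
          · rcases eq_or_ne l j with rfl | hj
            · simp [hv]
            · rw [Equiv.swap_apply_of_ne_of_ne hi hj]
        simp [this]
      change φ (fun l => g (c l) (v l)) + φ (fun l => g ((c ∘ Equiv.swap i j) l) (v l)) = 0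
      rw [h]
      exact φ.toAlternatingMap.map_add_swap _ hij
    · intro c _ hne heq
      apply hne
      have hc : c i = c j := by
        have := congrFun heq i
        simpa using this.symm
      exact φ.map_eq_zero_of_eq (fun l => g (c l) (v l)) (by simp [hc, hv]) hij
    · intro c hc
      rw [Finset.mem_piAntidiag] at hc ⊢
      refine ⟨?_, fun _ _ => Finset.mem_univ _⟩
      rw [← hc.1]
      exact Equiv.sum_comp (Equiv.swap i j) c
    · intro c _
      funext l
      simp

theorem pullbackCoeff_apply (g : ℕ → E →L[ℝ] E) (k : ℕ) {p : ℕ} (φ : E [⋀^Fin p]→L[ℝ] ℝ)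
    (u : Fin p → E) : pullbackCoeff g k φ u =
      ∑ c ∈ Finset.piAntidiag Finset.univ k, φ fun i => g (c i) (u i) := by
  change (∑ c ∈ Finset.piAntidiag Finset.univ k,
      φ.toContinuousMultilinearMap.compContinuousLinearMap fun i => g (c i)) u = _
  rw [_root_.sum_apply]
  rfl

/-- For skew-symmetric `B`, the alternating form
`(u_0, …, u_{q+1}) ↦ ∑_{i<j} (-1)^{i+j+1} B(u_i, u_j)(u_0, …, û_i, …, û_j, …, u_{q+1})`,
see `altTwo_apply` (where the pair `i < j` is written `(i.castSucc, j.succ)`). -/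
def altTwo {q : ℕ} (B : E →L[ℝ] E →L[ℝ] E [⋀^Fin q]→L[ℝ] ℝ) : E [⋀^Fin (q + 2)]→L[ℝ] ℝ :=
  (1 / 2 : ℝ) • ContinuousAlternatingMap.alternatizeUncurryFin
    (ContinuousAlternatingMap.alternatizeUncurryFinCLM ℝ E ℝ ∘L B)

theorem altTwo_apply {q : ℕ} (B : E →L[ℝ] E →L[ℝ] E [⋀^Fin q]→L[ℝ] ℝ)
    (hB : ∀ u w, B u w = - B w u) (u : Fin (q + 2) → E) :
    altTwo B u = ∑ i : Fin (q + 1), ∑ j ≥ i, (-1 : ℝ) ^ (i + j : ℕ) *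
      B (u i.castSucc) (u j.succ) (j.removeNth (i.castSucc.removeNth u)) := by
  rw [altTwo, ContinuousAlternatingMap.smul_apply,
    ContinuousAlternatingMap.alternatizeUncurryFin_alternatizeUncurryFinCLM_comp_apply,
    Finset.smul_sum]
  refine Finset.sum_congr rfl fun i _ => ?_
  rw [Finset.smul_sum]
  refine Finset.sum_congr rfl fun j _ => ?_
  rw [hB (u j.succ) (u i.castSucc)]
  simp
  ring

/-- `α ∧ i_v φ` for a two-form `α`, a vector `v` and a `p`-form `φ` (with `i_v φ = 0` if `p = 0`). -/
def wedgeInterior (α : E →L[ℝ] E →L[ℝ] ℝ) (v : E) :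
    {p : ℕ} → E [⋀^Fin p]→L[ℝ] ℝ → E [⋀^Fin (p + 1)]→L[ℝ] ℝ
  | 0, _ => 0
  | _ + 1, φ => altTwo ((ContinuousLinearMap.toSpanSingleton ℝ (φ.curryLeft v)).postcomp E ∘L α)

/-- `i_N φ` for `N ∈ ⋀² ⊗ T`, i.e. the composition of interior product and wedge product:
for `N = α ⊗ v` it is `α ∧ i_v φ`. -/
def insertTwoForm (N : E →L[ℝ] E →L[ℝ] E) :
    {p : ℕ} → E [⋀^Fin p]→L[ℝ] ℝ → E [⋀^Fin (p + 1)]→L[ℝ] ℝ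
  | 0, _ => 0
  | _ + 1, φ => altTwo (φ.curryLeft.postcomp E ∘L N)

theorem wedgeInterior_apply (α : E →L[ℝ] E →L[ℝ] ℝ) (hα : ∀ u, α u u = 0) (v : E) {q : ℕ}
    (φ : E [⋀^Fin (q + 1)]→L[ℝ] ℝ) (u : Fin (q + 2) → E) :
    wedgeInterior α v φ u = ∑ i : Fin (q + 1), ∑ j ≥ i, (-1 : ℝ) ^ (i + j : ℕ) *
      (α (u i.castSucc) (u j.succ) *
        φ (Matrix.vecCons v (j.removeNth (i.castSucc.removeNth u)))) := by
  have h : ∀ u w, α u w = - α w u := fun u w => by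
    have := hα (u + w)
    simp [hα] at this
    linarith
  rw [wedgeInterior, altTwo_apply]
  · simp
  · intro u w
    ext
    simp [h u w]

theorem insertTwoForm_apply (N : E →L[ℝ] E →L[ℝ] E) (hN : ∀ u, N u u = 0) {q : ℕ}
    (φ : E [⋀^Fin (q + 1)]→L[ℝ] ℝ) (u : Fin (q + 2) → E) :
    insertTwoForm N φ u = ∑ i : Fin (q + 1), ∑ j ≥ i, (-1 : ℝ) ^ (i + j : ℕ) *
      φ (Matrix.vecCons (N (u i.castSucc) (u j.succ))
        (j.removeNth (i.castSucc.removeNth u))) := by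
  have h : ∀ u w, N u w = - N w u := fun u w => by
    have := hN (u + w)
    simp [hN] at this
    exact eq_neg_of_add_eq_zero_left this
  rw [insertTwoForm, altTwo_apply]
  · simp
  · intro u w
    simp [h u w]

/-- The space `E²` spanned by all `α ∧ i_v Φ = (α ∧ i_v φ_1, …, α ∧ i_v φ_l)` with `α` a two-form
and `v` a vector. -/
def E2 {l : ℕ} {p : Fin l → ℕ} (Φ : ∀ i, E [⋀^Fin (p i)]→L[ℝ] ℝ) :
    Submodule ℝ (∀ i, E [⋀^Fin (p i + 1)]→L[ℝ] ℝ) :=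
  Submodule.span ℝ {ψ | ∃ α : E →L[ℝ] E →L[ℝ] ℝ, (∀ u, α u u = 0) ∧
    ∃ v : E, ψ = fun i => wedgeInterior α v (Φ i)}

/-- The `GL(E)`-orbit of `Φ = (φ_1, …, φ_l)`. -/
def glOrbit {l : ℕ} {p : Fin l → ℕ} (Φ : ∀ i, E [⋀^Fin (p i)]→L[ℝ] ℝ) :
    Set (∀ i, E [⋀^Fin (p i)]→L[ℝ] ℝ) :=
  {Ψ | ∃ g : E ≃L[ℝ] E, Ψ = fun i => (Φ i).compContinuousLinearMap (g : E →L[ℝ] E)}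

end LinearAlgebra

section Manifold

/-- The model space `ℝⁿ`. -/
abbrev Model (n : ℕ) : Type := EuclideanSpace ℝ (Fin n)

variable {n : ℕ} {X : Type*} [TopologicalSpace X] [ChartedSpace (Model n) X]

/-- Not necessarily smooth `p`-forms on `X`; the tangent space of `X` at each of its points is, by
definition in Mathlib, the model space. -/
abbrev FormField (n : ℕ) (X : Type*) [TopologicalSpace X] [ChartedSpace (Model n) X] (p : ℕ) :
    Type _ :=
  ∀ _x : X, Model n [⋀^Fin p]→L[ℝ] ℝ

/-- The derivative at `y` of the inverse of the preferred chart at `x₀`. -/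
def chartInvDeriv (x₀ : X) (y : Model n) : Model n →L[ℝ] Model n :=
  mfderiv 𝓘(ℝ, Model n) (𝓡 n) (extChartAt (𝓡 n) x₀).symm y

/-- The derivative at `x` of the preferred chart at `x`. -/
def chartDeriv (x : X) : Model n →L[ℝ] Model n :=
  mfderiv (𝓡 n) 𝓘(ℝ, Model n) (extChartAt (𝓡 n) x) x

/-- The form `η` in the preferred chart at `x₀`, i.e. its pull-back by the inverse of that chart. -/
def chartForm {p : ℕ} (η : FormField n X p) (x₀ : X) (y : Model n) : Model n [⋀^Fin p]→L[ℝ] ℝ :=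
  (η ((extChartAt (𝓡 n) x₀).symm y)).compContinuousLinearMap
    (chartInvDeriv x₀ y)

/-- Smoothness of a form: smoothness in charts. -/
def IsSmoothForm {p : ℕ} (η : FormField n X p) : Prop :=
  ∀ x₀ : X, ContDiffOn ℝ ∞ (chartForm η x₀) (extChartAt (𝓡 n) x₀).target

/-- The exterior derivative of a form on `X`, computed at `x` in the preferred chart at `x`. -/
def extD {p : ℕ} (η : FormField n X p) : FormField n X (p + 1) := fun x =>
  (extDeriv (chartForm η x) (extChartAt (𝓡 n) x x)).compContinuousLinearMap
    (chartDeriv x)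

variable [IsManifold (𝓡 n) ∞ X]

/-- `End(TX)`: the smooth fields of endomorphisms of the tangent bundle. -/
abbrev EndField (n : ℕ) (X : Type*) [TopologicalSpace X] [ChartedSpace (Model n) X]
    [IsManifold (𝓡 n) ∞ X] : Type _ :=
  Cₛ^∞⟮𝓡 n; Model n →L[ℝ] Model n,
    fun x : X => TangentSpace (𝓡 n) x →L[ℝ] TangentSpace (𝓡 n) x⟯

/-- The value at `x`, as an endomorphism of the model space. -/
def EndField.val (a : EndField n X) (x : X) : Model n →L[ℝ] Model n := a x

/-- The identity field. -/
def EndField.one : EndField n X where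
  toFun x := ContinuousLinearMap.id ℝ (TangentSpace (𝓡 n) x)
  contMDiff_toFun := by
    intro x₀
    rw [contMDiffAt_hom_bundle]
    refine ⟨contMDiffAt_id, ?_⟩
    refine (contMDiffAt_const (c := ContinuousLinearMap.id ℝ (Model n))).congr_of_eventuallyEq ?_
    filter_upwards [(trivializationAt (Model n) (TangentSpace (𝓡 n)) x₀).open_baseSet.mem_nhds
      (FiberBundle.mem_baseSet_trivializationAt' x₀)] with x hx
    ext v : 1
    simp [ContinuousLinearMap.inCoordinates_eq hx hx]

/-- Pointwise composition. -/
def EndField.mul (a b : EndField n X) : EndField n X where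
  toFun x := (a x).comp (b x)
  contMDiff_toFun := by
    intro x₀
    have ha := (contMDiffAt_hom_bundle _).1 (a.contMDiff x₀)
    have hb := (contMDiffAt_hom_bundle _).1 (b.contMDiff x₀)
    rw [contMDiffAt_hom_bundle]
    refine ⟨contMDiffAt_id, ?_⟩
    refine (ha.2.clm_comp hb.2).congr_of_eventuallyEq ?_
    filter_upwards [(trivializationAt (Model n) (TangentSpace (𝓡 n)) x₀).open_baseSet.mem_nhds
      (FiberBundle.mem_baseSet_trivializationAt' x₀)] with x hx
    simp only [ContinuousLinearMap.inCoordinates_eq hx hx]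
    ext v : 1
    simp only [ContinuousLinearMap.coe_comp, Function.comp_apply, ContinuousLinearEquiv.coe_coe,
      ContinuousLinearEquiv.symm_apply_apply]

instance : One (EndField n X) := ⟨EndField.one⟩
instance : Mul (EndField n X) := ⟨EndField.mul⟩

theorem EndField.one_apply (x : X) :
    (1 : EndField n X) x = ContinuousLinearMap.id ℝ (TangentSpace (𝓡 n) x) := rfl

theorem EndField.mul_apply (a b : EndField n X) (x : X) : (a * b) x = (a x).comp (b x) := rfl

instance : Ring (EndField n X) :=
  { (inferInstance : AddCommGroup (EndField n X)), (inferInstance : Mul (EndField n X)),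
    (inferInstance : One (EndField n X)) with
    left_distrib := fun a b c => by
      ext x v
      simp [EndField.mul_apply]
    right_distrib := fun a b c => by
      ext x v
      simp [EndField.mul_apply]
    zero_mul := fun a => by
      ext x v
      simp [EndField.mul_apply]
    mul_zero := fun a => by
      ext x v
      simp [EndField.mul_apply]
    mul_assoc := fun _ _ _ => rfl
    one_mul := fun _ => rfl
    mul_one := fun _ => rfl }

/-- The vector field `N(a,b)(U,V) = ab[U,V] + ba[U,V] + [aU,bV] - [aV,bU]
- a[bU,V] + a[bV,U] - b[aU,V] + b[aV,U]`. -/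
def nijenhuisField (a b : EndField n X) (U V : Π x : X, TangentSpace (𝓡 n) x) :
    Π x : X, TangentSpace (𝓡 n) x :=
  letI A : (Π x : X, TangentSpace (𝓡 n) x) → Π x : X, TangentSpace (𝓡 n) x :=
    fun W x => a x (W x)
  letI B : (Π x : X, TangentSpace (𝓡 n) x) → Π x : X, TangentSpace (𝓡 n) x :=
    fun W x => b x (W x)
  letI br := VectorField.mlieBracket (𝓡 n) (M := X)
  A (B (br U V)) + B (A (br U V)) + br (A U) (B V) - br (A V) (B U)
    - A (br (B U) V) + A (br (B V) U) - B (br (A U) V) + B (br (A V) U)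

/-- Differentiability of a vector field at a point. -/
abbrev DiffVFAt (U : Π x : X, TangentSpace (𝓡 n) x) (x : X) : Prop :=
  MDifferentiableAt (𝓡 n) ((𝓡 n).prod 𝓘(ℝ, Model n))
    (fun y => Bundle.TotalSpace.mk' (Model n) y (U y)) x

theorem EndField.mdiffAt_apply (a : EndField n X) {U : Π x : X, TangentSpace (𝓡 n) x} {x : X}
    (hU : DiffVFAt U x) : DiffVFAt (fun y => a y (U y)) x :=
  ((a.contMDiff x).mdifferentiableAt (by simp)).clm_bundle_apply hU

theorem nijenhuisField_swap (a b : EndField n X) (U V : Π x : X, TangentSpace (𝓡 n) x) :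
    nijenhuisField a b U V = - nijenhuisField a b V U := by
  funext x
  simp only [nijenhuisField, Pi.add_apply, Pi.sub_apply, Pi.neg_apply]
  rw [VectorField.mlieBracket_swap_apply (V := U) (W := V)]
  simp only [map_neg]
  module

theorem nijenhuisField_tensorial (a b : EndField n X) (x : X)
    (V : Π x : X, TangentSpace (𝓡 n) x) (_hV : DiffVFAt V x) :
    TensorialAt (𝓡 n) (Model n) (fun U => nijenhuisField a b U V x) x where
  smul {f U} hf hU := by
    have e (c : EndField n X) : (fun y => c y ((f • U) y)) = f • (fun y => c y (U y)) := by
      funext y; simp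
    have ha := a.mdiffAt_apply hU
    have hb := b.mdiffAt_apply hU
    simp only [nijenhuisField, Pi.add_apply, Pi.sub_apply, e,
      VectorField.mlieBracket_smul_left hf hU, VectorField.mlieBracket_smul_left hf ha,
      VectorField.mlieBracket_smul_left hf hb, VectorField.mlieBracket_smul_right hf hU,
      VectorField.mlieBracket_smul_right hf hb, map_add, map_smul]
    module
  add {U U'} hU hU' := by
    have e (c : EndField n X) :
        (fun y => c y ((U + U') y)) = (fun y => c y (U y)) + (fun y => c y (U' y)) := by
      funext y
      exact map_add (c y) (U y) (U' y)
    have ha := a.mdiffAt_apply hU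
    have hb := b.mdiffAt_apply hU
    have ha' := a.mdiffAt_apply hU'
    have hb' := b.mdiffAt_apply hU'
    simp only [nijenhuisField, e]
    simp only [Pi.add_apply, Pi.sub_apply,
      VectorField.mlieBracket_add_left hU hU', VectorField.mlieBracket_add_left ha ha',
      VectorField.mlieBracket_add_left hb hb', VectorField.mlieBracket_add_right hU hU',
      VectorField.mlieBracket_add_right hb hb', map_add]
    module

theorem nijenhuisField_tensorial' (a b : EndField n X) (x : X)
    (U : Π x : X, TangentSpace (𝓡 n) x) (hU : DiffVFAt U x) :
    TensorialAt (𝓡 n) (Model n) (fun V => nijenhuisField a b U V x) x where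
  smul {f V} hf hV := by
    rw [nijenhuisField_swap a b U, nijenhuisField_swap a b U, Pi.neg_apply, Pi.neg_apply,
      (nijenhuisField_tensorial a b x U hU).smul hf hV, smul_neg]
  add {V V'} hV hV' := by
    rw [nijenhuisField_swap a b U, nijenhuisField_swap a b U V, nijenhuisField_swap a b U V',
      Pi.neg_apply, Pi.neg_apply, Pi.neg_apply,
      (nijenhuisField_tensorial a b x U hU).add hV hV', neg_add]

/-- The tensor `N(a,b) ∈ ⋀² ⊗ T`; `nijenhuis_apply` computes it on vector fields. -/
def nijenhuis (a b : EndField n X) (x : X) :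
    TangentSpace (𝓡 n) x →L[ℝ] TangentSpace (𝓡 n) x →L[ℝ] TangentSpace (𝓡 n) x :=
  TensorialAt.mkHom₂ (fun U V => nijenhuisField a b U V x) x
    (nijenhuisField_tensorial a b x) (nijenhuisField_tensorial' a b x)

theorem nijenhuis_apply (a b : EndField n X) {x : X} {U V : Π x : X, TangentSpace (𝓡 n) x}
    (hU : DiffVFAt U x) (hV : DiffVFAt V x) :
    nijenhuis a b x (U x) (V x) = nijenhuisField a b U V x :=
  TensorialAt.mkHom₂_apply _ _ hU hV

/-- The value of `N(a,b)` at `x`, as a bilinear map on the model space. -/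
def nijenhuisVal (a b : EndField n X) (x : X) : Model n →L[ℝ] Model n →L[ℝ] Model n :=
  nijenhuis a b x

/-- `ρ̂_b η`. -/
def rhoHat (b : EndField n X) {p : ℕ} (η : FormField n X p) : FormField n X p :=
  fun x => infAction (b.val x) (η x)

/-- `L_b = [ρ̂_b, d]`. -/
def lieOp (b : EndField n X) {p : ℕ} (η : FormField n X p) : FormField n X (p + 1) :=
  rhoHat b (extD η) - extD (rhoHat b η)

/-- `i_{N(a,b)} η`. -/
def insertNijenhuis (a b : EndField n X) {p : ℕ} (η : FormField n X p) : FormField n X (p + 1) :=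
  fun x => insertTwoForm (nijenhuisVal a b x) (η x)

/-- Formal power series `∑ P_k t^k` of operators from `p`-forms to `q`-forms. -/
abbrev OpSeries (n : ℕ) (X : Type*) [TopologicalSpace X] [ChartedSpace (Model n) X] (p q : ℕ) :
    Type _ :=
  ℕ → FormField n X p → FormField n X q

/-- `a(t) = ∑_{k ≥ 1} (1/k!) a_k t^k ∈ End(TX)[[t]]` (the entry `a 0` is ignored). -/
def gaugeSeries (a : ℕ → EndField n X) : PowerSeries (EndField n X) :=
  PowerSeries.mk fun k => if k = 0 then 0 else (k.factorial : ℝ)⁻¹ • a k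

/-- `a_{<k}(t) = ∑_{1 ≤ j < k} (1/j!) a_j t^j`. -/
def gaugeSeriesLT (a : ℕ → EndField n X) (k : ℕ) : PowerSeries (EndField n X) :=
  gaugeSeries fun j => if j < k then a j else 0

/-- `exp A(t) = ∑_l (1/l!) A(t)^l` for a series `A(t)` without constant term; only the terms with
`l ≤ k` contribute to the coefficient of `t^k`. -/
def expSeries (A : PowerSeries (EndField n X)) : PowerSeries (EndField n X) :=
  PowerSeries.mk fun k => ∑ l ∈ Finset.range (k + 1),
    (l.factorial : ℝ)⁻¹ • PowerSeries.coeff k (A ^ l)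

/-- The coefficient of `t^k` in `ρ_{g(t)} η`. -/
def gaugeAction (g : PowerSeries (EndField n X)) {p : ℕ} : OpSeries n X p p := fun k η x =>
  pullbackCoeff (fun j => EndField.val (PowerSeries.coeff j g) x) k (η x)

/-- `ρ̂_{A(t)}^l` as a power series of operators. -/
def rhoHatPow (A : PowerSeries (EndField n X)) {p : ℕ} : ℕ → OpSeries n X p p
  | 0 => fun k η => if k = 0 then η else 0
  | l + 1 => fun k η => ∑ ij ∈ Finset.HasAntidiagonal.antidiagonal k,
      rhoHat (PowerSeries.coeff ij.1 A) (rhoHatPow A l ij.2 η)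

/-- `Ob_k(A) = ∑_{l=2}^k (1/l!) (d ρ̂_A^l)_k`. -/
def obstruction (A : PowerSeries (EndField n X)) {p : ℕ} : OpSeries n X p (p + 1) := fun k η =>
  ∑ l ∈ Finset.Icc 2 k, (l.factorial : ℝ)⁻¹ • extD (rhoHatPow A l k η)

/-- `G(A,A) = i_{N(A,A)} - L_{A²}` as a power series of operators. -/
def GSeries (A : PowerSeries (EndField n X)) {p : ℕ} : OpSeries n X p (p + 1) := fun k η =>
  (∑ ij ∈ Finset.HasAntidiagonal.antidiagonal k,
    insertNijenhuis (PowerSeries.coeff ij.1 A) (PowerSeries.coeff ij.2 A) η)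
  - lieOp (PowerSeries.coeff k (A * A)) η

/-- `Ad_{ρ̂_A} P = [ρ̂_A, P]` for power series of operators. -/
def adRho (A : PowerSeries (EndField n X)) {p : ℕ} (P : OpSeries n X p (p + 1)) :
    OpSeries n X p (p + 1) := fun k η =>
  ∑ ij ∈ Finset.HasAntidiagonal.antidiagonal k,
    (rhoHat (PowerSeries.coeff ij.1 A) (P ij.2 η) - P ij.2 (rhoHat (PowerSeries.coeff ij.1 A) η))

/-- The power series `f(x) = -1/2! + x/3! - x²/4! + ⋯`. -/
def fSeries : PowerSeries ℝ :=
  PowerSeries.mk fun m => (-1 : ℝ) ^ (m + 1) / ((m + 2).factorial : ℝ)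

/-- `f(Ad_{ρ̂_A}) G(A,A)` as a power series of operators, for `A` without constant term; then
`Ad_{ρ̂_A}^m G(A,A)` has no terms of degree less than `m + 2`, so that each sum is finite. -/
def fAdG (A : PowerSeries (EndField n X)) {p : ℕ} : OpSeries n X p (p + 1) := fun k η =>
  ∑ᶠ m : ℕ, PowerSeries.coeff m fSeries • ((adRho A)^[m] (GSeries A)) k η

/-- `Φ = (φ_1, …, φ_l)` is a smooth section of the bundle with fibre the orbit of `ΦV`, transported
to each tangent space by a linear identification with `V`. -/
def IsOrbitSection {V : Type*} [NormedAddCommGroup V] [NormedSpace ℝ V] {l : ℕ} {p : Fin l → ℕ}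
    (ΦV : ∀ i, V [⋀^Fin (p i)]→L[ℝ] ℝ) (Φ : ∀ i, FormField n X (p i)) : Prop :=
  (∀ i, IsSmoothForm (Φ i)) ∧ ∀ x : X, ∃ h : Model n ≃L[ℝ] V,
    (fun i => (Φ i x).compContinuousLinearMap (h.symm : V →L[ℝ] Model n)) ∈ glOrbit ΦV

/-- `Ψ ∈ Γ(E²)`: a smooth tuple of forms with values in the spaces `E²(T_x X)` defined by `Φ`. -/
def IsSectionE2 {l : ℕ} {p : Fin l → ℕ} (Φ : ∀ i, FormField n X (p i))
    (Ψ : ∀ i, FormField n X (p i + 1)) : Prop :=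
  (∀ i, IsSmoothForm (Ψ i)) ∧ ∀ x : X, (fun i => Ψ i x) ∈ E2 fun i => Φ i x

end Manifold
end GaugeDef
end

open GaugeDef

/-! Write `r = ρ̂_{a(t)}`. Since `ρ̂` is the differential of the action, `ρ_{exp a} = e^r`, and
formally `d e^r = e^r (e^{-ad_r} d)`. The series `e^r` starts with the identity. Hence, if `d e^r Φ`
vanishes in degrees below `k`, its coefficient in degree `k` is that of `(e^{-ad_r} d) Φ`. In the
latter series the term of order 0 contributes nothing for `k ≥ 1`, the term of order 1 is `-[r, d] Φ
= d ρ̂_a Φ` because `Φ` is closed, and the remaining terms are iterated commutators of `r` with `[r,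
[r, d]]`. Comparing with the direct expansion of `d e^r Φ` gives the formula for the obstruction.

The geometric input is `[ρ̂_a, L_b] = L_{ba} - i_{N(a,b)}` (`rhoHat_lieOp_commutator`), which for `a
= b` says `[r, [r, d]] = -G(a,a)`. It is checked pointwise: in a chart `L_b` involves only first
derivatives, and by tensoriality `N(a,b)` may be evaluated on coordinate fields. The bookkeeping is
done with `altAction M`, the operator `∑ e^i ∧ ρ̂_{M(e_i)}`, which equals `i_N` for `N` the skew
part `M - M.flip`.

For membership in `E²`, every iterated commutator has the form `altAction M + L_b`, with the same
`M` and `b` for all components (`exists_iterate_adRho_GSeries_eq`). The first summand is of the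
required form. For the second one needs that the derivative of `Φ` in a chart is tangent to the
orbit, i.e. equals `ρ̂_C Φ` for one tensor `C` (`IsOrbitSection.exists_chartFormDeriv_eq`). The
orbit is not assumed to be embedded. Instead, a local map `c` transversal to the orbit takes only
countably many values on it, so that `c ∘ Φ` is constant on small balls
(`IsC1Action.fderiv_mem_range`).

The formal computation takes place in an actual ring: power series over the endomorphisms of pairs
of smooth forms of degrees `p` and `p + 1`. Smoothness makes `d` linear, and pairs let `ρ̂` and `d`
be multiplied. Exactness is immediate from the definition of the obstruction and linearity of `d`.
-/

open scoped Manifold ContDiff Bundle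
noncomputable section
namespace GaugeDef
set_option synthInstance.maxHeartbeats 200000

/-! ### Pointwise algebra of `ρ̂` and of `i_N` -/

section LinearAlgebra
open ContinuousAlternatingMap hiding sub_apply add_apply map_zero smul_apply sum_apply
variable {E : Type*} [NormedAddCommGroup E] [NormedSpace ℝ E] {p : ℕ}

/-- The bilinear map `(φ, ξ) ↦ ρ̂_ξ φ`. -/
def infActionCLM (E : Type*) [NormedAddCommGroup E] [NormedSpace ℝ E] (p : ℕ) :
    (E [⋀^Fin p]→L[ℝ] ℝ) →L[ℝ] (E →L[ℝ] E) →L[ℝ] E [⋀^Fin p]→L[ℝ] ℝ :=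
  fderivCompContinuousLinearMapCLM ℝ (ContinuousLinearMap.id ℝ E)

theorem infActionCLM_apply (φ : E [⋀^Fin p]→L[ℝ] ℝ) (ξ : E →L[ℝ] E) :
    infActionCLM E p φ ξ = infAction ξ φ := rfl

theorem infAction_add_left (ξ ζ : E →L[ℝ] E) (φ : E [⋀^Fin p]→L[ℝ] ℝ) :
    infAction (ξ + ζ) φ = infAction ξ φ + infAction ζ φ :=
  map_add (infActionCLM E p φ) ξ ζ

theorem infAction_smul_left (c : ℝ) (ξ : E →L[ℝ] E) (φ : E [⋀^Fin p]→L[ℝ] ℝ) :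
    infAction (c • ξ) φ = c • infAction ξ φ :=
  map_smul (infActionCLM E p φ) c ξ

@[simp] theorem infAction_zero_left (φ : E [⋀^Fin p]→L[ℝ] ℝ) :
    infAction (0 : E →L[ℝ] E) φ = 0 :=
  map_zero (infActionCLM E p φ)

theorem infAction_add (ξ : E →L[ℝ] E) (φ ψ : E [⋀^Fin p]→L[ℝ] ℝ) :
    infAction ξ (φ + ψ) = infAction ξ φ + infAction ξ ψ := by
  rw [← infActionCLM_apply, ContinuousLinearMap.map_add]; rfl

theorem infAction_sub (ξ : E →L[ℝ] E) (φ ψ : E [⋀^Fin p]→L[ℝ] ℝ) :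
    infAction ξ (φ - ψ) = infAction ξ φ - infAction ξ ψ := by
  rw [eq_sub_iff_add_eq, ← infAction_add, sub_add_cancel]

theorem infAction_smul (c : ℝ) (ξ : E →L[ℝ] E) (φ : E [⋀^Fin p]→L[ℝ] ℝ) :
    infAction ξ (c • φ) = c • infAction ξ φ := by
  rw [← infActionCLM_apply, ContinuousLinearMap.map_smul]; rfl

@[simp] theorem infAction_zero (ξ : E →L[ℝ] E) :
    infAction ξ (0 : E [⋀^Fin p]→L[ℝ] ℝ) = 0 := by
  rw [← infActionCLM_apply, ContinuousLinearMap.map_zero]; rfl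

/-- `T` intertwines `b'` and `b`. This serves both for changing charts and for moving along an
orbit. -/
theorem infAction_comp (b b' T : E →L[ℝ] E) (h : T ∘L b' = b ∘L T) (φ : E [⋀^Fin p]→L[ℝ] ℝ) :
    (infAction b φ).compContinuousLinearMap T = infAction b' (φ.compContinuousLinearMap T) := by
  ext u
  simp only [compContinuousLinearMap_apply, infAction_apply]
  refine Finset.sum_congr rfl fun i _ => congrArg φ (funext fun j => ?_)
  have h' : T (b' (u i)) = b (T (u i)) := congrArg (fun f => f (u i)) h
  by_cases hj : j = i
  · subst hj; simp [h']
  · simp [Function.update_of_ne hj]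

/-- `ρ̂` is the differential of a right action. -/
theorem infAction_commutator (a c : E →L[ℝ] E) (φ : E [⋀^Fin p]→L[ℝ] ℝ) :
    infAction a (infAction c φ) - infAction c (infAction a φ) =
      infAction (c ∘L a - a ∘L c) φ := by
  ext u
  simp only [ContinuousAlternatingMap.sub_apply, infAction_apply]
  have key (f g : E →L[ℝ] E) (i : Fin p) :
      ∑ j, φ (Function.update (Function.update u i (f (u i))) j
        (g (Function.update u i (f (u i)) j))) =
      φ (Function.update u i (g (f (u i)))) + ∑ j ∈ Finset.univ.erase i,
        φ (Function.update (Function.update u i (f (u i))) j (g (u j))) := by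
    rw [← Finset.add_sum_erase _ _ (Finset.mem_univ i)]
    congr 1
    · simp
    · refine Finset.sum_congr rfl fun j hj => ?_
      rw [Function.update_of_ne (Finset.ne_of_mem_erase hj)]
  simp only [key, Finset.sum_add_distrib, _root_.sub_apply,
    ContinuousLinearMap.comp_apply, φ.map_update_sub, Finset.sum_sub_distrib]
  -- Terms in which `a` and `c` act in different slots cancel; only those acting twice in one slot
  -- survive.
  have hswap : ∑ i, ∑ j ∈ Finset.univ.erase i,
        φ (Function.update (Function.update u i (a (u i))) j (c (u j))) =
      ∑ i, ∑ j ∈ Finset.univ.erase i,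
        φ (Function.update (Function.update u i (c (u i))) j (a (u j))) := by
    rw [Finset.sum_comm' (t' := Finset.univ) (s' := fun j => Finset.univ.erase j)
      (by simp [eq_comm])]
    refine Finset.sum_congr rfl fun i _ => Finset.sum_congr rfl fun j hj => ?_
    rw [Function.update_comm (Finset.ne_of_mem_erase hj)]
  rw [hswap]
  ring

/-- `ρ̂_ξ` is a derivation: on `∑ e^i ∧ T(e_i)` it acts either on the slot fed to `T` or on the
slots of the form `T(e_i)`. -/
theorem infAction_alternatizeUncurryFin (ξ : E →L[ℝ] E) (T : E →L[ℝ] E [⋀^Fin p]→L[ℝ] ℝ) :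
    infAction ξ (alternatizeUncurryFin T) =
      alternatizeUncurryFin (T ∘L ξ + (infActionCLM E p).flip ξ ∘L T) := by
  ext u
  simp only [infAction_apply, alternatizeUncurryFin_apply, _root_.add_apply,
    ContinuousLinearMap.comp_apply, ContinuousLinearMap.flip_apply, infActionCLM_apply,
    ContinuousAlternatingMap.add_apply]
  rw [Finset.sum_comm]
  refine Finset.sum_congr rfl fun j _ => ?_
  rw [← Finset.smul_sum, Fin.sum_univ_succAbove _ j]
  simp [Fin.removeNth_update_succAbove, Function.update_of_ne, (Fin.succAbove_ne _ _).symm,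
    Fin.removeNth_apply]

/-- The operator `φ ↦ ∑ e^i ∧ ρ̂_{M(e_i)} φ` defined by `M ∈ T* ⊗ End(T)`; by
`altAction_eq_insertTwoForm` it only depends on the skew part of `M`. -/
def altAction (M : E →L[ℝ] E →L[ℝ] E) (φ : E [⋀^Fin p]→L[ℝ] ℝ) : E [⋀^Fin (p + 1)]→L[ℝ] ℝ :=
  alternatizeUncurryFin (infActionCLM E p φ ∘L M)

theorem altAction_add_left (M M' : E →L[ℝ] E →L[ℝ] E) (φ : E [⋀^Fin p]→L[ℝ] ℝ) :
    altAction (M + M') φ = altAction M φ + altAction M' φ := by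
  simp only [altAction, ContinuousLinearMap.comp_add, alternatizeUncurryFin_add]

theorem altAction_smul_left (c : ℝ) (M : E →L[ℝ] E →L[ℝ] E) (φ : E [⋀^Fin p]→L[ℝ] ℝ) :
    altAction (c • M) φ = c • altAction M φ := by
  simp only [altAction, ContinuousLinearMap.comp_smul, alternatizeUncurryFin_smul]

theorem altAction_zero_left (φ : E [⋀^Fin p]→L[ℝ] ℝ) :
    altAction (0 : E →L[ℝ] E →L[ℝ] E) φ = 0 := by
  rw [← zero_smul ℝ (0 : E →L[ℝ] E →L[ℝ] E), altAction_smul_left, zero_smul]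

theorem altAction_neg_left (M : E →L[ℝ] E →L[ℝ] E) (φ : E [⋀^Fin p]→L[ℝ] ℝ) :
    altAction (-M) φ = -altAction M φ := by
  rw [eq_neg_iff_add_eq_zero, ← altAction_add_left, neg_add_cancel, altAction_zero_left]

theorem altAction_sub_left (M M' : E →L[ℝ] E →L[ℝ] E) (φ : E [⋀^Fin p]→L[ℝ] ℝ) :
    altAction (M - M') φ = altAction M φ - altAction M' φ := by
  rw [sub_eq_add_neg, altAction_add_left, altAction_neg_left, sub_eq_add_neg]

theorem altAction_sum_left {ι : Type*} (s : Finset ι) (M : ι → E →L[ℝ] E →L[ℝ] E)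
    (φ : E [⋀^Fin p]→L[ℝ] ℝ) : altAction (∑ i ∈ s, M i) φ = ∑ i ∈ s, altAction (M i) φ :=
  map_sum (⟨⟨fun M => altAction M φ, altAction_zero_left φ⟩, fun M M' => altAction_add_left M M' φ⟩ :
    (E →L[ℝ] E →L[ℝ] E) →+ _) M s

theorem altAction_symm (M : E →L[ℝ] E →L[ℝ] E) (hM : ∀ u v, M u v = M v u)
    (φ : E [⋀^Fin p]→L[ℝ] ℝ) : altAction M φ = 0 :=
  alternatizeUncurryFin_fderivCompContinuousLinearMap_eq_zero φ _ hM

theorem altAction_skew (N : E →L[ℝ] E →L[ℝ] E) (φ : E [⋀^Fin p]→L[ℝ] ℝ) :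
    altAction N φ = (1 / 2 : ℝ) • altAction (N - N.flip) φ := by
  have h : altAction (N + N.flip) φ = 0 := altAction_symm _ (fun u v => add_comm (N u v) (N v u)) φ
  rw [altAction_add_left] at h
  rw [altAction_sub_left]
  rw [eq_neg_of_add_eq_zero_right h]
  module

/-- Because `ρ̂_ξ φ = ∑ (e^j ∘ ξ) ∧ i_{e_j} φ`, `altAction` is a double alternation, and so is
`altTwo` up to its factor `1/2`. In degree 0 both sides vanish. -/
theorem insertTwoForm_eq_altAction (N : E →L[ℝ] E →L[ℝ] E) (φ : E [⋀^Fin p]→L[ℝ] ℝ) :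
    insertTwoForm N φ = (1 / 2 : ℝ) • altAction N φ := by
  cases p with
  | zero =>
    rw [insertTwoForm, altAction]
    have : infActionCLM E 0 φ = 0 := by
      ext ξ u
      rw [infActionCLM_apply, infAction_apply]
      simp
    rw [this, ContinuousLinearMap.zero_comp]
    ext; simp [alternatizeUncurryFin_apply]
  | succ q =>
    rw [insertTwoForm, altTwo, altAction]
    congr 2
    ext u v : 2
    change _ = φ.fderivCompContinuousLinearMap (ContinuousLinearMap.id ℝ E) (N u) v
    rw [fderivCompContinuousLinearMap_eq_alternatizeUncurryFin]
    rfl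

theorem altAction_eq_insertTwoForm (M : E →L[ℝ] E →L[ℝ] E) (φ : E [⋀^Fin p]→L[ℝ] ℝ) :
    altAction M φ = insertTwoForm (M - M.flip) φ := by
  rw [insertTwoForm_eq_altAction, altAction_skew]

end LinearAlgebra

/-! ### Commutators with `altAction`, and membership in `E²` -/

section LinearAlgebra
open ContinuousAlternatingMap hiding sub_apply add_apply map_zero smul_apply sum_apply
variable {E : Type*} [NormedAddCommGroup E] [NormedSpace ℝ E] {p : ℕ}

theorem alternatizeUncurryFin_sub (S T : E →L[ℝ] E [⋀^Fin p]→L[ℝ] ℝ) :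
    alternatizeUncurryFin (S - T) = alternatizeUncurryFin S - alternatizeUncurryFin T := by
  rw [eq_sub_iff_add_eq, ← alternatizeUncurryFin_add, sub_add_cancel]

/-- The commutator is again algebraic: `a` acts on `M ∈ T* ⊗ End(T)` through the `T*` slot and
through the commutator of endomorphisms. -/
theorem infAction_altAction_commutator (a : E →L[ℝ] E) (M : E →L[ℝ] E →L[ℝ] E)
    (φ : E [⋀^Fin p]→L[ℝ] ℝ) :
    infAction a (altAction M φ) - altAction M (infAction a φ) =
      altAction (M ∘L a + ((ContinuousLinearMap.compL ℝ E E E).flip a ∘L M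
        - ContinuousLinearMap.compL ℝ E E E a ∘L M)) φ := by
  rw [altAction, infAction_alternatizeUncurryFin, altAction, ← alternatizeUncurryFin_sub, altAction]
  congr 1
  ext u : 1
  change infAction (M (a u)) φ + infAction a (infAction (M u) φ) - infAction (M u) (infAction a φ) =
    infAction (M (a u) + (M u ∘L a - a ∘L M u)) φ
  rw [infAction_add_left, ← infAction_commutator]
  abel

theorem wedgeInterior_eq_insertTwoForm (α : E →L[ℝ] E →L[ℝ] ℝ) (v : E)
    (φ : E [⋀^Fin p]→L[ℝ] ℝ) :
    wedgeInterior α v φ =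
      insertTwoForm ((ContinuousLinearMap.toSpanSingleton ℝ v).postcomp E ∘L α) φ := by
  cases p with
  | zero => rfl
  | succ q =>
    rw [wedgeInterior, insertTwoForm]
    congr 1
    ext u w : 2
    exact ((φ.curryLeft).map_smul (α u w) v).symm

theorem altAction_mem_E2 [FiniteDimensional ℝ E] {l : ℕ} {p : Fin l → ℕ}
    (Φ : ∀ i, E [⋀^Fin (p i)]→L[ℝ] ℝ) (M : E →L[ℝ] E →L[ℝ] E) :
    (fun i => altAction M (Φ i)) ∈ E2 Φ := by
  let e := Module.finBasis ℝ E
  let c (j) : E →L[ℝ] ℝ := (e.coord j).toContinuousLinearMap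
  -- Expanding the vector value of the skew tensor `N` in a basis writes it as `∑ α_j ⊗ e_j` with
  -- two-forms `α_j`.
  let N := M - M.flip
  let α (j) : E →L[ℝ] E →L[ℝ] ℝ := (c j).postcomp E ∘L N
  have hN : N = ∑ j, (ContinuousLinearMap.toSpanSingleton ℝ (e j)).postcomp E ∘L α j := by
    ext u w : 2
    rw [_root_.sum_apply, _root_.sum_apply]
    exact (e.sum_repr (N u w)).symm
  have h : (fun i => altAction M (Φ i)) = ∑ j, fun i => wedgeInterior (α j) (e j) (Φ i) := by
    funext i
    rw [altAction_eq_insertTwoForm, Finset.sum_apply]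
    change insertTwoForm N (Φ i) = _
    simp only [wedgeInterior_eq_insertTwoForm]
    conv_lhs => rw [hN]
    simp only [insertTwoForm_eq_altAction, altAction_sum_left, Finset.smul_sum]
  rw [h]
  refine Submodule.sum_mem _ fun j _ => Submodule.subset_span ⟨α j, fun u => ?_, e j, rfl⟩
  change c j (M u u - M u u) = 0
  rw [sub_self, _root_.map_zero]

end LinearAlgebra

/-! ### First-order computations in a vector space -/

section Flat
open ContinuousAlternatingMap hiding sub_apply add_apply map_zero smul_apply sum_apply
variable {E : Type*} [NormedAddCommGroup E] [NormedSpace ℝ E] {p : ℕ}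

theorem hasFDerivAt_infAction {b : E → E →L[ℝ] E} {η : E → E [⋀^Fin p]→L[ℝ] ℝ}
    {b' : E →L[ℝ] E →L[ℝ] E} {η' : E →L[ℝ] E [⋀^Fin p]→L[ℝ] ℝ} {y : E}
    (hb : HasFDerivAt b b' y) (hη : HasFDerivAt η η' y) :
    HasFDerivAt (fun z => infAction (b z) (η z))
      (infActionCLM E p (η y) ∘L b' + (infActionCLM E p).flip (b y) ∘L η') y :=
  (infActionCLM E p).hasFDerivAt_of_bilinear hη hb

/-- The value of `L_b η` in terms of the derivatives of `η` and `b`. -/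
theorem infAction_extDeriv_sub {b : E → E →L[ℝ] E} {η : E → E [⋀^Fin p]→L[ℝ] ℝ} {y : E}
    (hb : DifferentiableAt ℝ b y) (hη : DifferentiableAt ℝ η y) :
    infAction (b y) (extDeriv η y) - extDeriv (fun z => infAction (b z) (η z)) y =
      alternatizeUncurryFin (fderiv ℝ η y ∘L b y) - altAction (fderiv ℝ b y) (η y) := by
  rw [extDeriv, extDeriv, (hasFDerivAt_infAction hb.hasFDerivAt hη.hasFDerivAt).fderiv,
    infAction_alternatizeUncurryFin, alternatizeUncurryFin_add, alternatizeUncurryFin_add,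
    altAction]
  abel

/-- The tensor `M` with `[ρ̂_a, L_b] - L_{ba} = -∑ e^i ∧ ρ̂_{M(e_i)}`. -/
def commutatorTensor (a b : E →L[ℝ] E) (a' b' : E →L[ℝ] E →L[ℝ] E) : E →L[ℝ] E →L[ℝ] E :=
  b' ∘L a + a' ∘L b - ContinuousLinearMap.compL ℝ E E E a ∘L b'
    - ContinuousLinearMap.compL ℝ E E E b ∘L a'

theorem commutatorTensor_apply (a b : E →L[ℝ] E) (a' b' : E →L[ℝ] E →L[ℝ] E) (u v : E) :
    commutatorTensor a b a' b' u v = b' (a u) v + a' (b u) v - a (b' u v) - b (a' u v) := rfl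

/-- The formula `[ρ̂_a, L_b] = L_{ba} - i_{N(a,b)}` at one point, where `φ, φ'` stand for the value
and the derivative of a form. No second derivatives occur, as `ρ̂_a` has order 0 and `L_b` order 1.
The bracketed sum containing `a'` and `φ'` is the derivative of `ρ̂_a φ`. -/
theorem infAction_lie_commutator (a b : E →L[ℝ] E) (a' b' : E →L[ℝ] E →L[ℝ] E)
    (φ : E [⋀^Fin p]→L[ℝ] ℝ) (φ' : E →L[ℝ] E [⋀^Fin p]→L[ℝ] ℝ) :
    infAction a (alternatizeUncurryFin (φ' ∘L b) - altAction b' φ) -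
      (alternatizeUncurryFin ((infActionCLM E p φ ∘L a' + (infActionCLM E p).flip a ∘L φ') ∘L b)
        - altAction b' (infAction a φ)) =
    (alternatizeUncurryFin (φ' ∘L (b ∘L a)) -
      altAction ((ContinuousLinearMap.compL ℝ E E E).flip a ∘L b' +
        ContinuousLinearMap.compL ℝ E E E b ∘L a') φ) -
      altAction (commutatorTensor a b a' b') φ := by
  have h := infAction_altAction_commutator a b' φ
  rw [infAction_sub, infAction_alternatizeUncurryFin, eq_add_of_sub_eq h]
  simp only [commutatorTensor, altAction_add_left, altAction_sub_left]
  simp only [altAction, alternatizeUncurryFin_add, ContinuousLinearMap.add_comp,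
    ContinuousLinearMap.comp_assoc]
  abel

end Flat

/-! ### Forms, endomorphism fields and `d` in charts -/

section Charts
variable {n : ℕ} {X : Type*} [TopologicalSpace X] [ChartedSpace (Model n) X]
  {p : ℕ}

theorem chartInvDeriv_eq (x₀ : X) (y : Model n) : chartInvDeriv x₀ y =
    mfderivWithin 𝓘(ℝ, Model n) (𝓡 n) (extChartAt (𝓡 n) x₀).symm (Set.range (𝓡 n)) y := by
  rw [ModelWithCorners.range_eq_univ, mfderivWithin_univ]
  rfl

theorem target_mem_nhds (x : X) :
    (extChartAt (𝓡 n) x).target ∈ nhds (extChartAt (𝓡 n) x x) :=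
  extChartAt_target_mem_nhds x

theorem chartForm_add (η θ : FormField n X p) (x₀ : X) :
    chartForm (η + θ) x₀ = chartForm η x₀ + chartForm θ x₀ := rfl

theorem chartForm_smul (c : ℝ) (η : FormField n X p) (x₀ : X) :
    chartForm (c • η) x₀ = c • chartForm η x₀ := rfl

theorem IsSmoothForm.add {η θ : FormField n X p} (hη : IsSmoothForm η) (hθ : IsSmoothForm θ) :
    IsSmoothForm (η + θ) := fun x₀ => (hη x₀).add (hθ x₀)

theorem IsSmoothForm.const_smul {η : FormField n X p} (hη : IsSmoothForm η) (c : ℝ) :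
    IsSmoothForm (c • η) := fun x₀ => (hη x₀).const_smul c

theorem isSmoothForm_zero : IsSmoothForm (0 : FormField n X p) := fun _ => contDiffOn_const (c := 0)

theorem IsSmoothForm.sum {ι : Type*} {s : Finset ι} {η : ι → FormField n X p}
    (hη : ∀ i ∈ s, IsSmoothForm (η i)) : IsSmoothForm (∑ i ∈ s, η i) :=
  Finset.sum_induction _ _ (fun _ _ => IsSmoothForm.add) isSmoothForm_zero hη

theorem IsSmoothForm.differentiableAt {η : FormField n X p} (hη : IsSmoothForm η) (x : X) :
    DifferentiableAt ℝ (chartForm η x) (extChartAt (𝓡 n) x x) :=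
  ((hη x).contDiffAt (target_mem_nhds x)).differentiableAt (by simp)

variable [IsManifold (𝓡 n) ∞ X]

theorem isManifold_one : IsManifold (𝓡 n) 1 X := .of_le (n := ∞) (by simp)

/-- The derivative at `x` of the preferred chart at `x₀`. -/
def chartDerivAt (x₀ x : X) : Model n →L[ℝ] Model n :=
  mfderiv (𝓡 n) 𝓘(ℝ, Model n) (extChartAt (𝓡 n) x₀) x

theorem chartDerivAt_comp_chartInvDeriv {x₀ : X} {y : Model n}
    (hy : y ∈ (extChartAt (𝓡 n) x₀).target) :
    chartDerivAt x₀ ((extChartAt (𝓡 n) x₀).symm y) ∘L chartInvDeriv x₀ y =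
      ContinuousLinearMap.id ℝ _ := by
  have := isManifold_one (n := n) (X := X)
  rw [chartInvDeriv_eq]
  exact mfderiv_extChartAt_comp_mfderivWithin_extChartAt_symm hy

theorem chartInvDeriv_comp_chartDerivAt {x₀ : X} {y : Model n}
    (hy : y ∈ (extChartAt (𝓡 n) x₀).target) :
    chartInvDeriv x₀ y ∘L chartDerivAt x₀ ((extChartAt (𝓡 n) x₀).symm y) =
      ContinuousLinearMap.id ℝ _ := by
  have := isManifold_one (n := n) (X := X)
  rw [chartInvDeriv_eq]
  exact mfderivWithin_extChartAt_symm_comp_mfderiv_extChartAt hy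

/-- The tangent space at `x` is identified with the model space by the preferred chart at `x`
itself. -/
theorem chartDeriv_eq_id (x : X) : chartDeriv x = ContinuousLinearMap.id ℝ (Model n) := by
  have := isManifold_one (n := n) (X := X)
  exact mfderiv_extChartAt_self

theorem chartInvDeriv_self (x : X) :
    chartInvDeriv x (extChartAt (𝓡 n) x x) = ContinuousLinearMap.id ℝ (Model n) := by
  have := isManifold_one (n := n) (X := X)
  rw [chartInvDeriv_eq]
  exact mfderivWithin_range_extChartAt_symm

theorem chartForm_self (η : FormField n X p) (x : X) :
    chartForm η x (extChartAt (𝓡 n) x x) = η x := by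
  rw [chartForm, chartInvDeriv_self, extChartAt_to_inv]
  rfl

theorem extD_apply (η : FormField n X p) (x : X) :
    extD η x = extDeriv (chartForm η x) (extChartAt (𝓡 n) x x) := by
  rw [extD, chartDeriv_eq_id]
  rfl

/-- A field of endomorphisms in the preferred chart at `x₀`. -/
def chartEnd (b : EndField n X) (x₀ : X) (y : Model n) : Model n →L[ℝ] Model n :=
  chartDerivAt x₀ ((extChartAt (𝓡 n) x₀).symm y) ∘L b.val ((extChartAt (𝓡 n) x₀).symm y) ∘L
    chartInvDeriv x₀ y

theorem chartEnd_self (b : EndField n X) (x : X) :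
    chartEnd b x (extChartAt (𝓡 n) x x) = b.val x := by
  have h := chartDeriv_eq_id (n := n) x
  rw [chartEnd, chartInvDeriv_self, extChartAt_to_inv]
  change chartDeriv x ∘L _ = _
  rw [h]
  rfl

/-- Smoothness of a section of the endomorphism bundle is smoothness in the trivialization at `x₀`,
and this trivialization is conjugation by the derivative of the chart. -/
theorem contDiffOn_chartEnd (b : EndField n X) (x₀ : X) :
    ContDiffOn ℝ ∞ (chartEnd b x₀) (extChartAt (𝓡 n) x₀).target := by
  have hm := isManifold_one (n := n) (X := X)
  have h1 := ((trivializationAt (Model n →L[ℝ] Model n)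
    (fun x : X => TangentSpace (𝓡 n) x →L[ℝ] TangentSpace (𝓡 n) x) x₀).contMDiffOn_section_baseSet_iff
      (IB := 𝓡 n) (n := ∞)).1 b.contMDiff.contMDiffOn
  have h2 := contMDiffOn_extChartAt_symm (I := 𝓡 n) (n := ∞) x₀
  have h3 := h1.comp h2 (fun y hy => by
    have := (extChartAt (𝓡 n) x₀).map_target hy
    simpa using this)
  rw [contMDiffOn_iff_contDiffOn] at h3
  refine h3.congr fun y hy => ?_
  have hy' : (extChartAt (𝓡 n) x₀).symm y ∈ (chartAt (Model n) x₀).source := by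
    simpa using (extChartAt (𝓡 n) x₀).map_target hy
  have e1 := TangentBundle.continuousLinearMapAt_trivializationAt (I := 𝓡 n) hy'
  have e2 := TangentBundle.symmL_trivializationAt (I := 𝓡 n) hy'
  rw [(extChartAt (𝓡 n) x₀).right_inv hy] at e2
  rw [chartEnd, chartInvDeriv_eq, chartDerivAt]
  rw [Function.comp_apply, hom_trivializationAt_apply]
  change _ = (trivializationAt (Model n) (TangentSpace (𝓡 n)) x₀).continuousLinearMapAt ℝ _ ∘L
    b ((extChartAt (𝓡 n) x₀).symm y) ∘L
    (trivializationAt (Model n) (TangentSpace (𝓡 n)) x₀).symmL ℝ _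
  rw [e1, e2]
  rfl

theorem differentiableAt_chartEnd (b : EndField n X) (x : X) :
    DifferentiableAt ℝ (chartEnd b x) (extChartAt (𝓡 n) x x) :=
  ((contDiffOn_chartEnd b x).contDiffAt (target_mem_nhds x)).differentiableAt (by simp)

theorem chartForm_rhoHat (b : EndField n X) (η : FormField n X p) {x₀ : X} {y : Model n}
    (hy : y ∈ (extChartAt (𝓡 n) x₀).target) :
    chartForm (rhoHat b η) x₀ y = infAction (chartEnd b x₀ y) (chartForm η x₀ y) := by
  refine infAction_comp _ _ _ ?_ _
  rw [chartEnd, ← ContinuousLinearMap.comp_assoc, chartInvDeriv_comp_chartDerivAt hy]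
  rfl

theorem chartEnd_mul (a b : EndField n X) {x₀ : X} {y : Model n}
    (hy : y ∈ (extChartAt (𝓡 n) x₀).target) :
    chartEnd (a * b) x₀ y = chartEnd a x₀ y ∘L chartEnd b x₀ y := by
  have h := chartInvDeriv_comp_chartDerivAt hy
  ext v : 1
  have h' := congrArg (fun f => f (b.val ((extChartAt (𝓡 n) x₀).symm y) (chartInvDeriv x₀ y v))) h
  simp only [ContinuousLinearMap.comp_apply, ContinuousLinearMap.id_apply] at h'
  simp only [chartEnd, ContinuousLinearMap.comp_apply, h']
  rfl

theorem IsSmoothForm.rhoHat {η : FormField n X p} (hη : IsSmoothForm η) (b : EndField n X) :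
    IsSmoothForm (rhoHat b η) := fun x₀ => by
  refine ContDiffOn.congr ?_ fun y hy => chartForm_rhoHat b η hy
  exact ((infActionCLM (Model n) p).contDiff.comp_contDiffOn (hη x₀)).clm_apply
    (contDiffOn_chartEnd b x₀)

theorem extD_add {η θ : FormField n X p} (hη : IsSmoothForm η) (hθ : IsSmoothForm θ) :
    extD (η + θ) = extD η + extD θ := by
  funext x
  rw [Pi.add_apply, extD_apply, extD_apply, extD_apply, chartForm_add,
    extDeriv_add (hη.differentiableAt x) (hθ.differentiableAt x)]

theorem extD_smul (c : ℝ) (η : FormField n X p) : extD (c • η) = c • extD η := by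
  funext x
  rw [Pi.smul_apply, extD_apply, extD_apply, chartForm_smul, extDeriv_smul]

theorem extD_zero : extD (0 : FormField n X p) = 0 := by
  rw [← zero_smul ℝ (0 : FormField n X p), extD_smul, zero_smul]

theorem extD_sum {ι : Type*} {s : Finset ι} {η : ι → FormField n X p}
    (hη : ∀ i ∈ s, IsSmoothForm (η i)) : extD (∑ i ∈ s, η i) = ∑ i ∈ s, extD (η i) := by
  classical
  induction s using Finset.induction_on with
  | empty => simp [extD_zero]
  | insert i s hi ih =>
    rw [Finset.sum_insert hi, Finset.sum_insert hi, extD_add (hη i (by simp))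
      (.sum fun j hj => hη j (by simp [hj])), ih fun j hj => hη j (by simp [hj])]

/-- The exterior derivative can be computed in any chart. -/
theorem chartForm_extD {η : FormField n X p} (hη : IsSmoothForm η) {x₀ : X} {y : Model n}
    (hy : y ∈ (extChartAt (𝓡 n) x₀).target) :
    chartForm (extD η) x₀ y = extDeriv (chartForm η x₀) y := by
  have hm := isManifold_one (n := n) (X := X)
  set x := (extChartAt (𝓡 n) x₀).symm y with hx
  let τ : Model n → Model n := extChartAt (𝓡 n) x ∘ (extChartAt (𝓡 n) x₀).symm
  have hsymm {z} (hz : z ∈ (extChartAt (𝓡 n) x₀).target) :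
      MDifferentiableAt 𝓘(ℝ, Model n) (𝓡 n) (extChartAt (𝓡 n) x₀).symm z := by
    have := mdifferentiableWithinAt_extChartAt_symm (I := 𝓡 n) hz
    rwa [ModelWithCorners.range_eq_univ, mdifferentiableWithinAt_univ] at this
  have hτ {z} (hz : z ∈ (extChartAt (𝓡 n) x₀).target)
      (hz' : (extChartAt (𝓡 n) x₀).symm z ∈ (chartAt (Model n) x).source) :
      fderiv ℝ τ z = chartDerivAt x ((extChartAt (𝓡 n) x₀).symm z) ∘L chartInvDeriv x₀ z := by
    rw [← mfderiv_eq_fderiv]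
    exact mfderiv_comp z (mdifferentiableAt_extChartAt hz') (hsymm hz)
  have hnear : ∀ᶠ z in nhds y, z ∈ (extChartAt (𝓡 n) x₀).target ∧
      (extChartAt (𝓡 n) x₀).symm z ∈ (chartAt (Model n) x).source := by
    refine ((isOpen_extChartAt_target x₀).mem_nhds hy |> Filter.Eventually.and) ?_
    exact (hsymm hy).continuousAt.eventually
      ((chartAt (Model n) x).open_source.mem_nhds (mem_chart_source _ x))
  -- The two chart expressions of `η` differ by pull-back along the transition map `τ`; naturality
  -- of `extDeriv` then compares the two exterior derivatives.
  have heq : chartForm η x₀ =ᶠ[nhds y] fun z =>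
      (chartForm η x (τ z)).compContinuousLinearMap (fderiv ℝ τ z) := by
    filter_upwards [hnear] with z ⟨hz, hz'⟩
    have hz'' : (extChartAt (𝓡 n) x₀).symm z ∈ (extChartAt (𝓡 n) x).source := by simpa using hz'
    have ht : τ z ∈ (extChartAt (𝓡 n) x).target := (extChartAt (𝓡 n) x).map_source hz''
    have hi : (extChartAt (𝓡 n) x).symm (τ z) = (extChartAt (𝓡 n) x₀).symm z :=
      (extChartAt (𝓡 n) x).left_inv hz''
    have hc := chartInvDeriv_comp_chartDerivAt ht
    rw [hi] at hc
    rw [hτ hz hz', chartForm, chartForm, hi]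
    ext v
    have hv (w) := congrArg (fun f => f w) hc
    simp only [ContinuousLinearMap.comp_apply, ContinuousLinearMap.id_apply] at hv
    simp only [ContinuousAlternatingMap.compContinuousLinearMap_apply, Function.comp_def,
      ContinuousLinearMap.comp_apply, hv]
  have hτs : ContDiffAt ℝ ∞ τ y := by
    have h := contDiffWithinAt_ext_coord_change (I := 𝓡 n) (n := ∞) x x₀ (y := y) (by
      rw [PartialEquiv.trans_source'', PartialEquiv.symm_symm, PartialEquiv.symm_target]
      exact ⟨x, ⟨by rw [hx]; exact (extChartAt (𝓡 n) x₀).map_target hy, mem_extChartAt_source x⟩,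
        (extChartAt (𝓡 n) x₀).right_inv hy⟩)
    rwa [ModelWithCorners.range_eq_univ, contDiffWithinAt_univ] at h
  have hτy : τ y = extChartAt (𝓡 n) x x := rfl
  rw [heq.extDeriv_eq, extDeriv_pullback (r := ∞) (hτy ▸ hη.differentiableAt x) hτs
      (by rw [minSmoothness_of_isRCLikeNormedField]; exact WithTop.coe_le_coe.2 le_top),
    hτ hy (mem_chart_source _ x), chartForm, extD, ← hx, hτy]
  rfl

/-- Not evident from the definition, which uses a different chart at every point; `chartForm_extD`
replaces these by one fixed chart. -/
theorem IsSmoothForm.extD {η : FormField n X p} (hη : IsSmoothForm η) : IsSmoothForm (extD η) :=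
  fun x₀ => by
    refine ContDiffOn.congr ?_ fun y hy => chartForm_extD hη hy
    exact (ContinuousAlternatingMap.alternatizeUncurryFinCLM ℝ (Model n) ℝ).contDiff.comp_contDiffOn
      ((hη x₀).fderiv_of_isOpen (isOpen_extChartAt_target x₀) (m := ∞) (by rfl))

end Charts

/-! ### Coordinate vector fields -/

section CoordField
variable {n : ℕ} {X : Type*} [TopologicalSpace X] [ChartedSpace (Model n) X]

/-- The vector field with constant value `u` in the preferred chart at `x`. -/
def coordField (x : X) (u : Model n) : Π z : X, TangentSpace (𝓡 n) z :=
  fun z => chartInvDeriv x (extChartAt (𝓡 n) x z) u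

theorem coordField_eventually (x : X) (u : Model n) : ∀ᶠ y in nhds (extChartAt (𝓡 n) x x),
    coordField x u ((extChartAt (𝓡 n) x).symm y) = chartInvDeriv x y u := by
  filter_upwards [target_mem_nhds x] with y hy
  rw [coordField, (extChartAt (𝓡 n) x).right_inv hy]

end CoordField

/-! ### The commutator `[ρ̂_a, L_b]` and the tensor `N(a,b)` -/

section Commutators
open ContinuousAlternatingMap hiding sub_apply add_apply map_zero smul_apply sum_apply
variable {n : ℕ} {X : Type*} [TopologicalSpace X] [ChartedSpace (Model n) X]
  [IsManifold (𝓡 n) ∞ X] {p : ℕ}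

/-- The derivative at `x` of a field of endomorphisms in the preferred chart at `x`. -/
def chartEndDeriv (b : EndField n X) (x : X) : Model n →L[ℝ] Model n →L[ℝ] Model n :=
  fderiv ℝ (chartEnd b x) (extChartAt (𝓡 n) x x)

/-- The derivative at `x` of a form in the preferred chart at `x`. -/
def chartFormDeriv (η : FormField n X p) (x : X) : Model n →L[ℝ] Model n [⋀^Fin p]→L[ℝ] ℝ :=
  fderiv ℝ (chartForm η x) (extChartAt (𝓡 n) x x)

theorem chartForm_rhoHat_eventuallyEq (b : EndField n X) (η : FormField n X p) (x : X) :
    chartForm (rhoHat b η) x =ᶠ[nhds (extChartAt (𝓡 n) x x)]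
      fun y => infAction (chartEnd b x y) (chartForm η x y) := by
  filter_upwards [target_mem_nhds x] with y hy using chartForm_rhoHat b η hy

theorem chartFormDeriv_rhoHat (b : EndField n X) {η : FormField n X p} (hη : IsSmoothForm η)
    (x : X) : chartFormDeriv (rhoHat b η) x =
      infActionCLM (Model n) p (η x) ∘L chartEndDeriv b x +
        (infActionCLM (Model n) p).flip (b.val x) ∘L chartFormDeriv η x := by
  rw [chartFormDeriv, (chartForm_rhoHat_eventuallyEq b η x).fderiv_eq,
    (hasFDerivAt_infAction (differentiableAt_chartEnd b x).hasFDerivAt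
      (hη.differentiableAt x).hasFDerivAt).fderiv, chartForm_self, chartEnd_self]
  rfl

theorem chartEndDeriv_mul (a b : EndField n X) (x : X) : chartEndDeriv (a * b) x =
    ContinuousLinearMap.compL ℝ _ _ _ (a.val x) ∘L chartEndDeriv b x +
      (ContinuousLinearMap.compL ℝ _ _ _).flip (b.val x) ∘L chartEndDeriv a x := by
  have h : chartEnd (a * b) x =ᶠ[nhds (extChartAt (𝓡 n) x x)]
      fun y => chartEnd a x y ∘L chartEnd b x y := by
    filter_upwards [target_mem_nhds x] with y hy using chartEnd_mul a b hy
  rw [chartEndDeriv, h.fderiv_eq, ((differentiableAt_chartEnd a x).hasFDerivAt.clm_comp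
    (differentiableAt_chartEnd b x).hasFDerivAt).fderiv, chartEnd_self, chartEnd_self]
  rfl

theorem lieOp_apply (b : EndField n X) {η : FormField n X p} (hη : IsSmoothForm η) (x : X) :
    lieOp b η x = alternatizeUncurryFin (chartFormDeriv η x ∘L b.val x) -
      altAction (chartEndDeriv b x) (η x) := by
  have h := infAction_extDeriv_sub (differentiableAt_chartEnd b x) (hη.differentiableAt x)
  rw [chartEnd_self, chartForm_self, ← extD_apply,
    ← (chartForm_rhoHat_eventuallyEq b η x).extDeriv_eq, ← extD_apply] at h
  exact h

/-- The manifold bracket is computed by pulling both fields back to the chart at `x`, whose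
derivative at `x` is the identity, so nothing remains to be transported back. -/
theorem mlieBracket_eq_lieBracket {x : X} {P Q : Π x : X, TangentSpace (𝓡 n) x}
    {P' Q' : Model n → Model n}
    (hP : ∀ᶠ y in nhds (extChartAt (𝓡 n) x x),
      P ((extChartAt (𝓡 n) x).symm y) = chartInvDeriv x y (P' y))
    (hQ : ∀ᶠ y in nhds (extChartAt (𝓡 n) x x),
      Q ((extChartAt (𝓡 n) x).symm y) = chartInvDeriv x y (Q' y)) :
    VectorField.mlieBracket (𝓡 n) P Q x =
      VectorField.lieBracket ℝ P' Q' (extChartAt (𝓡 n) x x) := by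
  have hm := isManifold_one (n := n) (X := X)
  have key {R : Π x : X, TangentSpace (𝓡 n) x} {R' : Model n → Model n}
      (hR : ∀ᶠ y in nhds (extChartAt (𝓡 n) x x),
        R ((extChartAt (𝓡 n) x).symm y) = chartInvDeriv x y (R' y)) :
      VectorField.mpullbackWithin 𝓘(ℝ, Model n) (𝓡 n) (extChartAt (𝓡 n) x).symm R
        (Set.range (𝓡 n)) =ᶠ[nhds (extChartAt (𝓡 n) x x)] R' := by
    filter_upwards [hR, target_mem_nhds x] with y hy hyt
    rw [VectorField.mpullbackWithin_apply, hy]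
    have hinv := isInvertible_mfderivWithin_extChartAt_symm (I := 𝓡 n) hyt
    rw [chartInvDeriv_eq]
    exact hinv.inverse_apply_eq.2 rfl
  have hid (w : Model n) : (chartDeriv x).inverse w = w := by
    rw [chartDeriv_eq_id, ContinuousLinearMap.inverse_id]
    rfl
  rw [← VectorField.mlieBracketWithin_univ, VectorField.mlieBracketWithin_apply]
  refine (hid _).trans ?_
  have hset : (extChartAt (𝓡 n) x).symm ⁻¹' Set.univ ∩ Set.range (𝓡 n) = Set.univ := by
    rw [ModelWithCorners.range_eq_univ, Set.preimage_univ, Set.inter_univ]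
  rw [hset, ← VectorField.lieBracketWithin_univ]
  exact Filter.EventuallyEq.lieBracketWithin_vectorField_eq_nhds (𝕜 := ℝ) (key hP) (key hQ)

theorem coordField_self (x : X) (u : Model n) : coordField x u x = u := by
  rw [coordField, chartInvDeriv_self]
  rfl

theorem endField_coordField_eventually (c : EndField n X) (x : X) (u : Model n) :
    ∀ᶠ y in nhds (extChartAt (𝓡 n) x x),
      (fun z => c z (coordField x u z)) ((extChartAt (𝓡 n) x).symm y) =
        chartInvDeriv x y (chartEnd c x y u) := by
  filter_upwards [coordField_eventually x u, target_mem_nhds x] with y hy hyt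
  rw [hy]
  exact (congrArg (fun f => f (c.val ((extChartAt (𝓡 n) x).symm y) (chartInvDeriv x y u)))
    (chartInvDeriv_comp_chartDerivAt hyt)).symm

/-- Near `x` the field is constant in the trivialization of the tangent bundle at `x`. -/
theorem diffVFAt_coordField (x : X) (u : Model n) : DiffVFAt (coordField x u) x := by
  have hm := isManifold_one (n := n) (X := X)
  refine ContMDiffAt.mdifferentiableAt (n := ∞) ?_ (by simp)
  rw [(trivializationAt (Model n) (TangentSpace (𝓡 n)) x).contMDiffAt_section_iff
    (FiberBundle.mem_baseSet_trivializationAt' x)]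
  refine (contMDiffAt_const (c := u)).congr_of_eventuallyEq ?_
  filter_upwards [(chartAt (Model n) x).open_source.mem_nhds (mem_chart_source _ x)] with z hz
  have hz' : z ∈ (trivializationAt (Model n) (TangentSpace (𝓡 n)) x).baseSet := by simpa using hz
  have h : coordField x u z =
      (trivializationAt (Model n) (TangentSpace (𝓡 n)) x).symmL ℝ z u := by
    rw [TangentBundle.symmL_trivializationAt (I := 𝓡 n) hz, coordField, chartInvDeriv_eq]
    rfl
  rw [h]
  have h2 := (trivializationAt (Model n) (TangentSpace (𝓡 n)) x).continuousLinearMapAt_symmL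
    (R := ℝ) hz' u
  rwa [Bundle.Trivialization.continuousLinearMapAt_apply, Bundle.Trivialization.linearMapAt_apply,
    if_pos hz'] at h2

theorem fderiv_chartEnd_apply (c : EndField n X) (x : X) (u w : Model n) :
    fderiv ℝ (fun y => chartEnd c x y u) (extChartAt (𝓡 n) x x) w = chartEndDeriv c x w u := by
  rw [fderiv_clm_apply (differentiableAt_chartEnd c x) (differentiableAt_const u)]
  simp [chartEndDeriv]

theorem mlieBracket_coordField (x : X) (u v : Model n) :
    VectorField.mlieBracket (𝓡 n) (coordField x u) (coordField x v) x = (0 : Model n) := by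
  rw [mlieBracket_eq_lieBracket (coordField_eventually x u) (coordField_eventually x v)]
  simp [VectorField.lieBracket]
  rfl

theorem mlieBracket_endField_coordField (a b : EndField n X) (x : X) (u v : Model n) :
    VectorField.mlieBracket (𝓡 n) (fun z => a z (coordField x u z))
      (fun z => b z (coordField x v z)) x =
      chartEndDeriv b x (a.val x u) v - chartEndDeriv a x (b.val x v) u := by
  rw [mlieBracket_eq_lieBracket (endField_coordField_eventually a x u)
    (endField_coordField_eventually b x v), VectorField.lieBracket, fderiv_chartEnd_apply,
    fderiv_chartEnd_apply, chartEnd_self, chartEnd_self]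

theorem mlieBracket_endField_coordField_left (a : EndField n X) (x : X) (u v : Model n) :
    VectorField.mlieBracket (𝓡 n) (fun z => a z (coordField x u z)) (coordField x v) x =
      -chartEndDeriv a x v u := by
  rw [mlieBracket_eq_lieBracket (endField_coordField_eventually a x u)
    (coordField_eventually x v), VectorField.lieBracket, fderiv_chartEnd_apply]
  simp
  rfl

/-- By tensoriality the fields may be coordinate fields. Then `[U,V] = 0`, which kills the terms
with `ab` and `ba`, and the six other brackets are first derivatives of `a` and `b`. -/
theorem nijenhuisVal_apply (a b : EndField n X) (x : X) (u v : Model n) :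
    nijenhuisVal a b x u v =
      commutatorTensor (a.val x) (b.val x) (chartEndDeriv a x) (chartEndDeriv b x) u v -
      commutatorTensor (a.val x) (b.val x) (chartEndDeriv a x) (chartEndDeriv b x) v u := by
  have h := nijenhuis_apply a b (diffVFAt_coordField x u) (diffVFAt_coordField x v)
  rw [coordField_self, coordField_self] at h
  refine Eq.trans h ?_
  simp only [nijenhuisField, Pi.add_apply, Pi.sub_apply]
  rw [mlieBracket_coordField, mlieBracket_endField_coordField, mlieBracket_endField_coordField,
    mlieBracket_endField_coordField_left, mlieBracket_endField_coordField_left,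
    mlieBracket_endField_coordField_left, mlieBracket_endField_coordField_left]
  simp only [commutatorTensor_apply]
  let A := a.val x
  let B := b.val x
  change A (B 0) + B (A 0) + (_ - _ : Model n) - (_ - _ : Model n) - A (-_) + A (-_) - B (-_)
    + B (-_) = _
  simp only [map_neg, map_zero, A, B]
  abel

theorem nijenhuisVal_eq (a b : EndField n X) (x : X) :
    nijenhuisVal a b x =
      commutatorTensor (a.val x) (b.val x) (chartEndDeriv a x) (chartEndDeriv b x) -
      (commutatorTensor (a.val x) (b.val x) (chartEndDeriv a x) (chartEndDeriv b x)).flip := by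
  ext u v : 2
  exact nijenhuisVal_apply a b x u v

theorem insertNijenhuis_apply (a b : EndField n X) (η : FormField n X p) (x : X) :
    insertNijenhuis a b η x = altAction
      (commutatorTensor (a.val x) (b.val x) (chartEndDeriv a x) (chartEndDeriv b x)) (η x) := by
  rw [altAction_eq_insertTwoForm, ← nijenhuisVal_eq]
  rfl

/-- `[ρ̂_a, L_b] = L_{ba} - i_{N(a,b)}`. -/
theorem rhoHat_lieOp_commutator (a b : EndField n X) {η : FormField n X p}
    (hη : IsSmoothForm η) :
    rhoHat a (lieOp b η) - lieOp b (rhoHat a η) = lieOp (b * a) η - insertNijenhuis a b η := by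
  funext x
  have h := infAction_lie_commutator (a.val x) (b.val x) (chartEndDeriv a x) (chartEndDeriv b x)
    (η x) (chartFormDeriv η x)
  rw [← chartFormDeriv_rhoHat a hη, ← lieOp_apply b hη] at h
  rw [Pi.sub_apply, Pi.sub_apply, lieOp_apply b (hη.rhoHat a), lieOp_apply (b * a) hη,
    insertNijenhuis_apply, chartEndDeriv_mul, add_comm (_ ∘L _)]
  exact h

end Commutators

/-! ### Maps with values in an orbit have tangent derivatives -/

section C1Action

/-- The inverse function theorem, with the derivative of the inverse known at all points near `F 0`
and not only there: `G ∘ F` is the identity near each nearby point `G w`. -/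
theorem exists_localInverse {M W : Type*} [NormedAddCommGroup M] [NormedSpace ℝ M]
    [FiniteDimensional ℝ M] [NormedAddCommGroup W] [NormedSpace ℝ W] [FiniteDimensional ℝ W]
    {F : M → W} {F' : M → M →L[ℝ] W} (hF : ∀ q, HasFDerivAt F (F' q) q) (hFc : ContDiff ℝ 1 F)
    (hbij : Function.Bijective (F' 0)) :
    ∃ G : W → M, G (F 0) = 0 ∧ ContinuousAt G (F 0) ∧ ∀ᶠ w in nhds (F 0),
      DifferentiableAt ℝ G w ∧ F (G w) = w ∧ ∀ v, fderiv ℝ G w (F' (G w) v) = v := by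
  have : CompleteSpace M := FiniteDimensional.complete ℝ M
  let F₀ : M ≃L[ℝ] W :=
    (LinearEquiv.ofBijective (F' 0).toLinearMap hbij).toContinuousLinearEquiv
  have hF₀ : (F₀ : M →L[ℝ] W) = F' 0 := rfl
  have hstrict : HasStrictFDerivAt F (F₀ : M →L[ℝ] W) 0 :=
    hFc.contDiffAt.hasStrictFDerivAt' (hF₀ ▸ hF 0) one_ne_zero
  have hG : ContDiffAt ℝ 1 (hstrict.localInverse F F₀ 0) (F 0) :=
    hFc.contDiffAt.to_localInverse (f' := F₀) (hF₀ ▸ hF 0) one_ne_zero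
  have hG0 : hstrict.localInverse F F₀ 0 (F 0) = 0 := hstrict.localInverse_apply_image
  have hleft := hstrict.eventually_left_inverse.eventually_nhds
  have hright := hstrict.eventually_right_inverse
  generalize hstrict.localInverse F F₀ 0 = G at hG hG0 hleft hright
  have hleft' : ∀ᶠ q in nhds (G (F 0)), ∀ᶠ z in nhds q, G (F z) = z := by rwa [hG0]
  refine ⟨G, hG0, hG.continuousAt, ?_⟩
  filter_upwards [hG.continuousAt.eventually hleft', hG.eventually (by simp), hright]
    with w hw1 hw2 hw3
  have hd := hw2.differentiableAt one_ne_zero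
  refine ⟨hd, hw3, fun v => ?_⟩
  have h1 := HasFDerivAt.comp (g := G) (g' := fderiv ℝ G w) (G w)
    (by rw [hw3]; exact hd.hasFDerivAt) (hF (G w))
  have h2 := h1.congr_of_eventuallyEq (f₁ := id) (by filter_upwards [hw1] with z hz using hz.symm)
  exact congrArg (fun f => f v) (h2.unique (hasFDerivAt_id _))

/-- `A` maps a complement of its kernel isomorphically onto its range, and `S` complements the
range. -/
theorem bijective_add_of_isCompl {U W : Type*} [AddCommGroup U] [Module ℝ U]
    [AddCommGroup W] [Module ℝ W] (A : U →ₗ[ℝ] W) {m : Submodule ℝ U} {S : Submodule ℝ W}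
    (hm : IsCompl (LinearMap.ker A) m) (hS : IsCompl (LinearMap.range A) S) :
    Function.Bijective (fun q : m × S => A q.1 + (q.2 : W)) := by
  constructor
  · intro q q' hq
    have hq' : A (q.1 - q'.1 : U) = (q'.2 - q.2 : W) := by
      rw [map_sub, sub_eq_sub_iff_add_eq_add, add_comm (q'.2 : W)]
      exact hq
    have h2 : (q'.2 - q.2 : W) = 0 :=
      Submodule.disjoint_def.1 hS.disjoint _ ⟨_, hq'⟩ (S.sub_mem q'.2.2 q.2.2)
    have h1 : (q.1 - q'.1 : U) = 0 :=
      Submodule.disjoint_def.1 hm.disjoint _ (hq'.trans h2) (m.sub_mem q.1.2 q'.1.2)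
    exact Prod.ext (Subtype.ext (sub_eq_zero.1 h1)) (Subtype.ext (sub_eq_zero.1 h2).symm)
  · intro w
    obtain ⟨w₁, ⟨ξ, rfl⟩, w₂, hw₂, rfl⟩ := Submodule.mem_sup.1
      (hS.sup_eq_top ▸ Submodule.mem_top : w ∈ _ ⊔ S)
    obtain ⟨ξ₁, hξ₁, ξ₂, hξ₂, rfl⟩ := Submodule.mem_sup.1
      (hm.sup_eq_top ▸ Submodule.mem_top : ξ ∈ _ ⊔ m)
    refine ⟨(⟨ξ₂, hξ₂⟩, ⟨w₂, hw₂⟩), ?_⟩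
    have : A ξ₁ = 0 := hξ₁
    simp [this]

/-- A `C¹` right action of the units of a finite-dimensional algebra on a finite-dimensional space;
`A w` is the derivative of `u ↦ act (u, w)` at `1`. -/
structure IsC1Action {U W : Type*} [NormedRing U] [NormedAlgebra ℝ U] [NormedAddCommGroup W]
    [NormedSpace ℝ W] (act : U × W → W) (A : W → U →L[ℝ] W) : Prop where
  contDiff : ContDiff ℝ 1 act
  one : ∀ w, act (1, w) = w
  fderiv_one : ∀ w ξ ψ, fderiv ℝ act (1, w) (ξ, ψ) = A w ξ + ψ
  fderiv_inl : ∀ u h w ξ, u * h = 1 → fderiv ℝ act (u, w) (ξ, 0) = A (act (u, w)) (h * ξ)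
  finrank_le : ∀ u w, IsUnit u → Module.finrank ℝ (LinearMap.range (A (act (u, w))).toLinearMap) ≤
    Module.finrank ℝ (LinearMap.range (A w).toLinearMap)

namespace IsC1Action
variable {U W : Type*} [NormedRing U] [NormedAlgebra ℝ U] [FiniteDimensional ℝ U]
  [NormedAddCommGroup W] [NormedSpace ℝ W] {act : U × W → W} {A : W → U →L[ℝ] W}

/-- A function which is constant along the orbit of `w₀` to first order on an open set takes only
countably many values on the part of the orbit in this set. -/
theorem countable_image (hact : IsC1Action act A) {w₀ : W} {S : Type*} [NormedAddCommGroup S]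
    [NormedSpace ℝ S] {c : W → S} {O : Set W} (hO : IsOpen O)
    (hc : ∀ w ∈ O, DifferentiableAt ℝ c w ∧ ((∃ u, IsUnit u ∧ w = act (u, w₀)) →
        ∀ ζ, fderiv ℝ c w (A w ζ) = 0)) :
    ((fun u => c (act (u, w₀))) '' {u | IsUnit u ∧ act (u, w₀) ∈ O}).Countable := by
  have : CompleteSpace U := FiniteDimensional.complete ℝ U
  have : SecondCountableTopology U :=
    have := FiniteDimensional.proper ℝ U
    inferInstance
  set Ω := {u | IsUnit u ∧ act (u, w₀) ∈ O}
  have hcont : Continuous fun u => act (u, w₀) :=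
    hact.contDiff.continuous.comp (by fun_prop)
  have hΩ : IsOpen Ω := Units.isOpen.inter (hO.preimage hcont)
  have hd (u) : HasFDerivAt (fun u => act (u, w₀))
      (fderiv ℝ act (u, w₀) ∘L ContinuousLinearMap.inl ℝ U W) u :=
    (hact.contDiff.differentiable one_ne_zero (u, w₀)).hasFDerivAt.comp u
      (hasFDerivAt_prodMk_left u w₀)
  have hzero (u) (hu : u ∈ Ω) : HasFDerivAt (fun u => c (act (u, w₀))) (0 : U →L[ℝ] S) u := by
    have h := (hc _ hu.2).1.hasFDerivAt.comp u (hd u)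
    have e : fderiv ℝ c (act (u, w₀)) ∘L
        (fderiv ℝ act (u, w₀) ∘L ContinuousLinearMap.inl ℝ U W) = 0 := by
      ext ξ
      obtain ⟨h', hh⟩ := hu.1.exists_right_inv
      -- With `h'` inverse to `u`, `u + εξ = u (1 + ε h' ξ)`, so moving `u` in the direction `ξ`
      -- moves the orbit point in the tangent direction given by `h' ξ`.
      have := (hc _ hu.2).2 ⟨u, hu.1, rfl⟩ (h' * ξ)
      rw [← hact.fderiv_inl u h' w₀ ξ hh] at this
      exact this
    rwa [e] at h
  have hloc (u) (hu : u ∈ Ω) : ∃ B ∈ nhdsWithin u Ω, ∀ v ∈ B, c (act (v, w₀)) = c (act (u, w₀)) := by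
    obtain ⟨ε, hε, hB⟩ := Metric.isOpen_iff.1 hΩ u hu
    refine ⟨Metric.ball u ε, mem_nhdsWithin_of_mem_nhds (Metric.ball_mem_nhds u hε), fun v hv => ?_⟩
    exact Metric.isOpen_ball.is_const_of_fderiv_eq_zero (𝕜 := ℝ)
      (f := fun u => c (act (u, w₀))) (convex_ball u ε).isPreconnected
      (fun z hz => (hzero z (hB hz)).differentiableAt.differentiableWithinAt)
      (fun z hz => (hzero z (hB hz)).fderiv) hv (Metric.mem_ball_self hε)
  choose! B hB hBc using hloc
  -- Local constancy and second countability of `U` leave countably many values.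
  obtain ⟨t, ht, htc, hcov⟩ := TopologicalSpace.countable_cover_nhdsWithin hB
  refine (htc.image fun u => c (act (u, w₀))).mono ?_
  rintro _ ⟨u, hu, rfl⟩
  obtain ⟨v, hv, huv⟩ := Set.mem_iUnion₂.1 (hcov hu)
  exact ⟨v, hv, (hBc v (ht hv) u huv).symm⟩

variable [FiniteDimensional ℝ W]

/-- Near `w₀` there is a `C¹` map whose differential at `w₀` has the tangent space to the orbit as
its kernel and whose differential vanishes on the tangent spaces to the orbit. -/
theorem exists_transversal (hact : IsC1Action act A) (w₀ : W) :
    ∃ (S : Submodule ℝ W) (c : W → S),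
      (∀ᶠ w in nhds w₀, DifferentiableAt ℝ c w ∧ ((∃ u, IsUnit u ∧ w = act (u, w₀)) →
        ∀ ζ, fderiv ℝ c w (A w ζ) = 0)) ∧
      ∀ ψ, fderiv ℝ c w₀ ψ = 0 → ∃ ζ, ψ = A w₀ ζ := by
  have : CompleteSpace U := FiniteDimensional.complete ℝ U
  obtain ⟨m, hm⟩ := Submodule.exists_isCompl (LinearMap.ker (A w₀).toLinearMap)
  obtain ⟨S, hS⟩ := Submodule.exists_isCompl (LinearMap.range (A w₀).toLinearMap)
  -- `F(ξ, s) = act(1 + ξ, w₀ + s)` with `m` complementary to the stabilizer algebra and `S`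
  -- complementary to the tangent space of the orbit. It is a local diffeomorphism at 0, and `c` is
  -- the `S`-component of its inverse.
  let ι : m × S →L[ℝ] U × W := m.subtypeL.prodMap S.subtypeL
  let κ : m × S → U × W := fun q => (1, w₀) + ι q
  let F : m × S → W := fun q => act (κ q)
  let F' (q) : m × S →L[ℝ] W := fderiv ℝ act (κ q) ∘L ι
  have hF (q) : HasFDerivAt F (F' q) q :=
    (hact.contDiff.differentiable one_ne_zero (κ q)).hasFDerivAt.comp q
      (ι.hasFDerivAt.const_add _)
  have hFc : ContDiff ℝ 1 F := hact.contDiff.comp (contDiff_const.add ι.contDiff)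
  have hκ0 : κ 0 = (1, w₀) := by simp [κ]
  have hF0 : F 0 = w₀ := by simp only [F, hκ0, hact.one]
  have hD0 (q : m × S) : F' 0 q = A w₀ q.1 + q.2 := by
    simp only [F', hκ0]
    exact hact.fderiv_one _ _ _
  have hbij : Function.Bijective (F' 0) := by
    have e : ⇑(F' 0) = fun q : m × S => (A w₀).toLinearMap q.1 + (q.2 : W) := funext hD0
    rw [e]
    exact bijective_add_of_isCompl (A w₀).toLinearMap hm hS
  obtain ⟨G, hG0, hGc, hG⟩ := exists_localInverse hF hFc hbij
  have hunit : ∀ᶠ q in nhds (G (F 0)), IsUnit (κ q).1 := by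
    have h : Continuous fun q => (κ q).1 := (continuous_const.add ι.continuous).fst
    refine h.continuousAt.eventually (Units.isOpen.mem_nhds ?_)
    simp [hG0, hκ0]
  have hunit' := hGc.eventually hunit
  rw [hF0] at hG0 hG hunit'
  have hc {w} (hd : DifferentiableAt ℝ G w) (v) :
      fderiv ℝ (fun w => (G w).2) w v = (fderiv ℝ G w v).2 := by
    rw [(hd.hasFDerivAt.snd).fderiv]
    rfl
  refine ⟨S, fun w => (G w).2, ?_, ?_⟩
  · filter_upwards [hG, hunit'] with w ⟨hd, hw, hinv⟩ hu
    refine ⟨hd.snd, fun ⟨g, hgu, hg⟩ ζ => ?_⟩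
    let T : m →ₗ[ℝ] W := (F' (G w) ∘L ContinuousLinearMap.inl ℝ m S).toLinearMap
    have hTinv (ξ : m) : fderiv ℝ G w (T ξ) = (ξ, 0) := hinv (ξ, 0)
    have hTinj : Function.Injective T := fun ξ ξ' hξ => by
      have := (hTinv ξ).symm.trans ((congrArg _ hξ).trans (hTinv ξ'))
      exact (Prod.ext_iff.1 this).1
    have hTle : LinearMap.range T ≤ LinearMap.range (A w).toLinearMap := by
      rintro _ ⟨ξ, rfl⟩
      obtain ⟨h, hh⟩ := hu.exists_right_inv
      have h1 := hact.fderiv_inl _ h (κ (G w)).2 (ξ : U) hh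
      have h2 : act (κ (G w)) = w := hw
      rw [Prod.mk.eta, h2] at h1
      refine ⟨h * ξ, h1.symm.trans ?_⟩
      simp [T, F', ι]
    -- The range of `T` consists of directions in which `c` is stationary and lies in the range of
    -- `A w`. On the orbit the latter has rank at most that of `A w₀`, which is `dim m`, the rank of
    -- `T`. So the two ranges coincide.
    have hrank : Module.finrank ℝ (LinearMap.range (A w).toLinearMap) ≤
        Module.finrank ℝ (LinearMap.range T) := by
      rw [LinearMap.finrank_range_of_inj hTinj, hg]
      refine (hact.finrank_le g w₀ hgu).trans ?_
      have h1 := LinearMap.finrank_range_add_finrank_ker (A w₀).toLinearMap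
      have h2 := Submodule.finrank_add_eq_of_isCompl hm
      omega
    have heq := Submodule.eq_of_le_of_finrank_le hTle hrank
    obtain ⟨ξ, hξ⟩ : A w ζ ∈ LinearMap.range T := heq ▸ ⟨ζ, rfl⟩
    rw [hc hd, ← hξ, hTinv]
  · intro Ψ hΨ
    obtain ⟨hd, -, hinv⟩ := hG.self_of_nhds
    rw [hc hd] at hΨ
    obtain ⟨q, rfl⟩ := hbij.2 Ψ
    have h := hinv q
    rw [hG0] at h
    have h2 : q.2 = 0 := (congrArg Prod.snd h).symm.trans hΨ
    refine ⟨q.1, (hD0 q).trans ?_⟩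
    rw [h2]
    simp

/-- A map with values in an orbit has derivatives tangent to this orbit. -/
theorem fderiv_mem_range (hact : IsC1Action act A) {E : Type*} [NormedAddCommGroup E]
    [NormedSpace ℝ E] {γ : E → W} {y₀ : E} (hd : DifferentiableAt ℝ γ y₀)
    (hγ : ∀ᶠ y in nhds y₀, ContinuousAt γ y)
    (horb : ∀ᶠ y in nhds y₀, ∃ u, IsUnit u ∧ γ y = act (u, γ y₀)) (v : E) :
    ∃ ζ, fderiv ℝ γ y₀ v = A (γ y₀) ζ := by
  obtain ⟨S, c, hc, hker⟩ := hact.exists_transversal (γ y₀)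
  refine hker _ ?_
  obtain ⟨O, hOc, hO, hOm⟩ := eventually_nhds_iff.1 hc
  have hcount := hact.countable_image hO hOc
  have hmem : ∀ᶠ y in nhds y₀, γ y ∈ O := hd.continuousAt.eventually (hO.mem_nhds hOm)
  obtain ⟨ε, hε, hball⟩ := Metric.eventually_nhds_iff_ball.1 (hγ.and (horb.and hmem))
  have himage : (c ∘ γ) '' Metric.ball y₀ ε ⊆
      (fun u => c (act (u, γ y₀))) '' {u | IsUnit u ∧ act (u, γ y₀) ∈ O} := by
    rintro _ ⟨y, hy, rfl⟩
    obtain ⟨-, ⟨u, hu, huy⟩, hyO⟩ := hball y hy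
    exact ⟨u, ⟨hu, huy ▸ hyO⟩, by rw [Function.comp_apply, huy]⟩
  have hconn : IsPreconnected ((c ∘ γ) '' Metric.ball y₀ ε) :=
    (convex_ball y₀ ε).isPreconnected.image _ fun y hy =>
      (((hOc _ (hball y hy).2.2).1.continuousAt).comp (hball y hy).1).continuousWithinAt
  -- The image of a ball under `c ∘ γ` is connected and countable, hence a single point.
  have hsub := hcount.isTotallyDisconnected _ himage hconn
  have hconst : (c ∘ γ) =ᶠ[nhds y₀] fun _ => c (γ y₀) := by
    filter_upwards [Metric.ball_mem_nhds y₀ hε] with y hy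
    exact hsub ⟨y, hy, rfl⟩ ⟨y₀, Metric.mem_ball_self hε, rfl⟩
  have h1 := ((hOc _ hOm).1.hasFDerivAt.comp y₀ hd.hasFDerivAt).congr_of_eventuallyEq hconst.symm
  exact congrArg (fun f => f v) (h1.unique (hasFDerivAt_const _ y₀))

end IsC1Action

end C1Action

/-! ### The action of `GL(E)` on tuples of forms -/

section Orbit
open ContinuousAlternatingMap hiding sub_apply add_apply map_zero smul_apply sum_apply
variable {E : Type*} [NormedAddCommGroup E] [NormedSpace ℝ E] {l : ℕ} {p : Fin l → ℕ}

/-- Tuples of alternating forms. -/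
abbrev FormTuple (E : Type*) [NormedAddCommGroup E] [NormedSpace ℝ E] {l : ℕ} (p : Fin l → ℕ) :
    Type _ := ∀ i, E [⋀^Fin (p i)]→L[ℝ] ℝ

/-- The pull-back of a tuple of forms. -/
def pullTuple (g : E →L[ℝ] E) (Φ : FormTuple E p) : FormTuple E p :=
  fun i => (Φ i).compContinuousLinearMap g

/-- The map `ξ ↦ ρ̂_ξ Φ`, whose range is the tangent space at `Φ` to its orbit. -/
def tupleAction (Φ : FormTuple E p) : (E →L[ℝ] E) →L[ℝ] FormTuple E p :=
  ContinuousLinearMap.pi fun i => infActionCLM E (p i) (Φ i)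

/-- The derivative of `(g, Φ) ↦ pullTuple g Φ`. -/
def pullTupleDeriv (g : E →L[ℝ] E) (Φ : FormTuple E p) :
    (E →L[ℝ] E) × FormTuple E p →L[ℝ] FormTuple E p :=
  ContinuousLinearMap.pi fun i =>
    compContinuousLinearMapCLM g ∘L (ContinuousLinearMap.proj i ∘L .snd ℝ _ _) +
      (Φ i).fderivCompContinuousLinearMap g ∘L .fst ℝ _ _

theorem hasFDerivAt_pullTuple (q : (E →L[ℝ] E) × FormTuple E p) :
    HasFDerivAt (fun q : (E →L[ℝ] E) × FormTuple E p => pullTuple q.1 q.2)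
      (pullTupleDeriv q.1 q.2) q := by
  refine hasFDerivAt_pi.2 fun i => ?_
  exact HasFDerivAt.continuousAlternatingMapCompContinuousLinearMap
    (f := fun q : (E →L[ℝ] E) × FormTuple E p => q.2 i)
    ((ContinuousLinearMap.proj i ∘L .snd ℝ (E →L[ℝ] E) (FormTuple E p)).hasFDerivAt)
    (ContinuousLinearMap.fst ℝ (E →L[ℝ] E) (FormTuple E p)).hasFDerivAt

/-- To first order `g + ε g ζ = g (1 + ε ζ)`, so the derivative at `g` reduces to the derivative at
the identity of the pulled-back form. -/
theorem fderivCompContinuousLinearMap_comp {q : ℕ} (φ : E [⋀^Fin q]→L[ℝ] ℝ) (g ζ : E →L[ℝ] E) :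
    φ.fderivCompContinuousLinearMap g (g ∘L ζ) = infAction ζ (φ.compContinuousLinearMap g) := by
  ext u
  rw [infAction_apply, fderivCompContinuousLinearMap_apply]
  refine Finset.sum_congr rfl fun i _ => congrArg φ (funext fun j => ?_)
  by_cases h : j = i
  · subst h; simp
  · simp [Function.update_of_ne h]

theorem pullTupleDeriv_inl {g h : E →L[ℝ] E} (hgh : g ∘L h = ContinuousLinearMap.id ℝ E)
    (Φ : FormTuple E p) (ξ : E →L[ℝ] E) :
    pullTupleDeriv g Φ (ξ, 0) = tupleAction (pullTuple g Φ) (h ∘L ξ) := by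
  funext i
  have : ξ = g ∘L (h ∘L ξ) := by
    rw [← ContinuousLinearMap.comp_assoc, hgh, ContinuousLinearMap.id_comp]
  conv_lhs => rw [this]
  change compContinuousLinearMapCLM g (0 : E [⋀^Fin (p i)]→L[ℝ] ℝ) + _ = _
  rw [ContinuousLinearMap.map_zero, zero_add]
  exact fderivCompContinuousLinearMap_comp _ _ _

theorem pullTuple_id (Φ : FormTuple E p) :
    pullTuple (ContinuousLinearMap.id ℝ E) Φ = Φ := rfl

theorem pullTupleDeriv_id (Φ : FormTuple E p) (ξ : E →L[ℝ] E) (Ψ : FormTuple E p) :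
    pullTupleDeriv (ContinuousLinearMap.id ℝ E) Φ (ξ, Ψ) = tupleAction Φ ξ + Ψ := by
  funext i
  exact add_comm _ _

/-- Pull-back by `g` carries `ρ̂_{gζg⁻¹} Φ` to `ρ̂_ζ` of the pulled-back tuple, so the tangent space
at the new point is contained in the image of the old one. -/
theorem finrank_range_tupleAction_le [FiniteDimensional ℝ E] (g : E ≃L[ℝ] E) (Φ : FormTuple E p) :
    Module.finrank ℝ (LinearMap.range (tupleAction (pullTuple (g : E →L[ℝ] E) Φ)).toLinearMap) ≤
      Module.finrank ℝ (LinearMap.range (tupleAction Φ).toLinearMap) := by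
  let T : FormTuple E p →ₗ[ℝ] FormTuple E p :=
    { toFun := pullTuple (g : E →L[ℝ] E)
      map_add' := fun _ _ => rfl
      map_smul' := fun _ _ => rfl }
  refine le_trans (Submodule.finrank_mono ?_)
    (Submodule.finrank_map_le T (LinearMap.range (tupleAction Φ).toLinearMap))
  rintro _ ⟨ζ, rfl⟩
  refine ⟨_, ⟨(g : E →L[ℝ] E) ∘L ζ ∘L (g.symm : E →L[ℝ] E), rfl⟩, ?_⟩
  funext i
  refine infAction_comp _ _ _ ?_ _
  ext v
  simp

variable [FiniteDimensional ℝ E]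

instance finiteDimensional_multilinear (q : ℕ) :
    FiniteDimensional ℝ (ContinuousMultilinearMap ℝ (fun _ : Fin q => E) ℝ) :=
  Module.Finite.of_injective
    (ContinuousMultilinearMap.toMultilinearMapLinear (R' := ℝ) (A := ℝ) (M₁ := fun _ : Fin q => E)
      (M₂ := ℝ)) ContinuousMultilinearMap.toMultilinearMap_injective

instance finiteDimensional_alternating (q : ℕ) : FiniteDimensional ℝ (E [⋀^Fin q]→L[ℝ] ℝ) :=
  Module.Finite.of_injective
    (toContinuousMultilinearMapLI (𝕜 := ℝ) (E := E) (F := ℝ) (ι := Fin q)).toLinearMap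
    (toContinuousMultilinearMapLI (𝕜 := ℝ) (E := E) (F := ℝ) (ι := Fin q)).injective

theorem contDiff_pullTuple :
    ContDiff ℝ 1 (fun q : (E →L[ℝ] E) × FormTuple E p => pullTuple q.1 q.2) := by
  refine contDiff_pi.2 fun i => ?_
  let J := (toContinuousMultilinearMapLI (𝕜 := ℝ) (E := E) (F := ℝ) (ι := Fin (p i)))
  -- Smoothness is known for pull-back of multilinear maps; a linear left inverse `K` of the
  -- inclusion `J` brings it back to alternating ones.
  obtain ⟨K, hK⟩ := LinearMap.exists_leftInverse_of_injective J.toLinearMap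
    (LinearMap.ker_eq_bot.2 J.injective)
  have h : ContDiff ℝ 1 fun q : (E →L[ℝ] E) × FormTuple E p =>
      ContinuousMultilinearMap.compContinuousLinearMapContinuousMultilinear ℝ
        (fun _ : Fin (p i) => E) (fun _ => E) ℝ (fun _ => q.1) (J (q.2 i)) := by
    refine ContDiff.clm_apply ?_ ?_
    · exact (ContinuousMultilinearMap.contDiff _).comp (contDiff_pi.2 fun _ => contDiff_fst)
    · exact J.toContinuousLinearMap.contDiff.comp
        ((ContinuousLinearMap.proj i : FormTuple E p →L[ℝ] _).contDiff.comp contDiff_snd)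
  have h2 := K.toContinuousLinearMap.contDiff.comp h
  convert h2 using 1
  funext q
  exact (congrArg (fun f => f (pullTuple q.1 q.2 i)) hK).symm

theorem isC1Action_pullTuple :
    IsC1Action (fun q : (E →L[ℝ] E) × FormTuple E p => pullTuple q.1 q.2) tupleAction where
  contDiff := contDiff_pullTuple
  one := pullTuple_id
  fderiv_one w ξ ψ := by
    rw [(hasFDerivAt_pullTuple _).fderiv]
    exact pullTupleDeriv_id w ξ ψ
  fderiv_inl u h w ξ hu := by
    rw [(hasFDerivAt_pullTuple _).fderiv]
    exact pullTupleDeriv_inl hu w ξ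
  finrank_le u w hu := by
    obtain ⟨u, rfl⟩ := hu
    exact finrank_range_tupleAction_le (ContinuousLinearEquiv.unitsEquiv ℝ E u) w

end Orbit

/-! ### Derivatives of orbit sections, and `L_b Φ` as an algebraic expression -/

section OrbitSection
open ContinuousAlternatingMap hiding sub_apply add_apply map_zero smul_apply sum_apply
variable {n : ℕ} {X : Type*} [TopologicalSpace X] [ChartedSpace (Model n) X]
  [IsManifold (𝓡 n) ∞ X] {V : Type*} [NormedAddCommGroup V] [NormedSpace ℝ V] {l : ℕ}
  {p : Fin l → ℕ} {ΦV : ∀ i, V [⋀^Fin (p i)]→L[ℝ] ℝ} {Φ : ∀ i, FormField n X (p i)}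

theorem IsOrbitSection.exists_chartForm_eq (hΦ : IsOrbitSection ΦV Φ) {x₀ : X} {y : Model n}
    (hy : y ∈ (extChartAt (𝓡 n) x₀).target) :
    ∃ T : Model n ≃L[ℝ] V, ∀ i, chartForm (Φ i) x₀ y =
      (ΦV i).compContinuousLinearMap (T : Model n →L[ℝ] V) := by
  obtain ⟨h, g, hg⟩ := hΦ.2 ((extChartAt (𝓡 n) x₀).symm y)
  let T₀ : Model n ≃L[ℝ] Model n := ContinuousLinearEquiv.equivOfInverse' (chartInvDeriv x₀ y)
    (chartDerivAt x₀ ((extChartAt (𝓡 n) x₀).symm y)) (chartInvDeriv_comp_chartDerivAt hy)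
    (chartDerivAt_comp_chartInvDeriv hy)
  refine ⟨(T₀.trans h).trans g, fun i => ?_⟩
  have hi := congrFun hg i
  ext u
  have := congrArg (fun f => f fun j => h (chartInvDeriv x₀ y (u j))) hi
  simp only [compContinuousLinearMap_apply, Function.comp_def, ContinuousLinearEquiv.coe_coe,
    ContinuousLinearEquiv.symm_apply_apply] at this
  exact this

/-- The derivatives of a section with values in an orbit are tangent to the orbit. -/
theorem IsOrbitSection.exists_chartFormDeriv_eq (hΦ : IsOrbitSection ΦV Φ) (x : X) :
    ∃ C : Model n →L[ℝ] Model n →L[ℝ] Model n, ∀ i,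
      chartFormDeriv (Φ i) x = infActionCLM (Model n) (p i) (Φ i x) ∘L C := by
  let γ : Model n → FormTuple (Model n) p := fun y i => chartForm (Φ i) x y
  let y₀ : Model n := extChartAt (𝓡 n) x x
  have hγ₀ : γ y₀ = fun i => Φ i x := funext fun i => chartForm_self (Φ i) x
  have hd : HasFDerivAt γ (ContinuousLinearMap.pi fun i => chartFormDeriv (Φ i) x) y₀ :=
    hasFDerivAt_pi.2 fun i => ((hΦ.1 i).differentiableAt x).hasFDerivAt
  have hcont : ∀ᶠ y in nhds y₀, ContinuousAt γ y := by
    filter_upwards [target_mem_nhds x] with y hy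
    exact continuousAt_pi.2 fun i => ((hΦ.1 i) x).continuousOn.continuousAt
      ((isOpen_extChartAt_target x).mem_nhds hy)
  have horb : ∀ᶠ y in nhds y₀, ∃ u : Model n →L[ℝ] Model n, IsUnit u ∧
      γ y = pullTuple u (γ y₀) := by
    obtain ⟨T₀, hT₀⟩ := hΦ.exists_chartForm_eq (mem_extChartAt_target (I := 𝓡 n) x)
    filter_upwards [target_mem_nhds x] with y hy
    obtain ⟨T, hT⟩ := hΦ.exists_chartForm_eq hy
    refine ⟨_, ((ContinuousLinearEquiv.unitsEquiv ℝ (Model n)).symm (T.trans T₀.symm)).isUnit,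
      funext fun i => ?_⟩
    change chartForm (Φ i) x y = (chartForm (Φ i) x y₀).compContinuousLinearMap _
    rw [hT i, hT₀ i]
    ext u
    refine congrArg (ΦV i) (funext fun j => ?_)
    exact (T₀.apply_symm_apply (T (u j))).symm
  have key (v : Model n) : ∃ ζ : Model n →L[ℝ] Model n, ∀ i,
      chartFormDeriv (Φ i) x v = infAction ζ (Φ i x) := by
    obtain ⟨ζ, hζ⟩ := (isC1Action_pullTuple (E := Model n) (p := p)).fderiv_mem_range
      hd.differentiableAt hcont horb v
    rw [hd.fderiv, hγ₀] at hζ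
    exact ⟨ζ, fun i => congrFun hζ i⟩
  -- The chosen `ζ v` need not be linear in `v`. Since `ρ̂_ζ` is linear in `ζ`, it suffices to keep
  -- its values on a basis and extend linearly.
  choose ζ hζ using key
  let e := Module.finBasis ℝ (Model n)
  let C := (e.constr ℝ fun j => ζ (e j)).toContinuousLinearMap
  refine ⟨C, fun i => ?_⟩
  apply ContinuousLinearMap.coe_injective
  refine e.ext fun j => ?_
  have hC : C (e j) = ζ (e j) := e.constr_basis ℝ _ j
  change chartFormDeriv (Φ i) x (e j) = infAction (C (e j)) (Φ i x)
  rw [hC, hζ]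

/-- In a chart `L_b Φ` is the alternation of `DΦ ∘ b` minus `altAction (Db) Φ`. Substituting `DΦ =
ρ̂_C Φ`, with one `C` for all components, makes it algebraic. -/
theorem IsOrbitSection.exists_lieOp_eq (hΦ : IsOrbitSection ΦV Φ) (b : EndField n X) (x : X) :
    ∃ M : Model n →L[ℝ] Model n →L[ℝ] Model n, ∀ i, lieOp b (Φ i) x = altAction M (Φ i x) := by
  obtain ⟨C, hC⟩ := hΦ.exists_chartFormDeriv_eq x
  refine ⟨C ∘L b.val x - chartEndDeriv b x, fun i => ?_⟩
  rw [lieOp_apply b (hΦ.1 i), hC i, altAction_sub_left]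
  rfl

end OrbitSection

open Finset.HasAntidiagonal (antidiagonal mem_antidiagonal)

/-! ### Reindexing of compositions, and orders of powers -/

section PiAntidiag
variable {ι : Type*} [Fintype ι] [DecidableEq ι]

theorem sum_update_add (c : ι → ℕ) (l : ι) (a : ℕ) :
    Finset.univ.sum (Function.update c l a) + c l = Finset.univ.sum c + a := by
  rw [Finset.sum_update_of_mem (Finset.mem_univ l), ← Finset.add_sum_erase _ c (Finset.mem_univ l),
    Finset.sdiff_singleton_eq_erase]
  ring

/-- Splitting the entry `c l` as `a + b` and taking `b` out is the same as choosing first the part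
`x` taken out and then a composition of the remainder. -/
theorem sum_piAntidiag_antidiagonal {M : Type*} [AddCommMonoid M] (N : ℕ) (l : ι)
    (f : (ι → ℕ) → ℕ → M) :
    ∑ c ∈ Finset.piAntidiag Finset.univ N, ∑ ab ∈ antidiagonal (c l),
      f (Function.update c l ab.1) ab.2 =
    ∑ xy ∈ antidiagonal N, ∑ c ∈ Finset.piAntidiag Finset.univ xy.2, f c xy.1 := by
  rw [Finset.sum_sigma', Finset.sum_sigma']
  refine Finset.sum_bij'
    (fun q _ => ⟨(q.2.2, N - q.2.2), Function.update q.1 l q.2.1⟩)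
    (fun q _ => ⟨Function.update q.2 l (q.2 l + q.1.1), (q.2 l, q.1.1)⟩) ?_ ?_ ?_ ?_ ?_
  · rintro ⟨c, a, b⟩ h
    simp only [Finset.mem_sigma, Finset.mem_piAntidiag, mem_antidiagonal, Finset.mem_univ,
      implies_true, and_true] at h ⊢
    have h1 := sum_update_add c l a
    have h2 : c l ≤ Finset.univ.sum c := Finset.single_le_sum (fun _ _ => Nat.zero_le _) (Finset.mem_univ l)
    omega
  · rintro ⟨⟨x, y⟩, c⟩ h
    simp only [Finset.mem_sigma, Finset.mem_piAntidiag, mem_antidiagonal, Finset.mem_univ,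
      implies_true, and_true, Function.update_self] at h ⊢
    have h1 := sum_update_add c l (c l + x)
    omega
  · rintro ⟨c, a, b⟩ h
    simp only [Finset.mem_sigma, mem_antidiagonal] at h
    simp [h.2]
  · rintro ⟨⟨x, y⟩, c⟩ h
    simp only [Finset.mem_sigma, mem_antidiagonal] at h
    have : N - x = y := by omega
    simp [this]
  · rintro ⟨c, a, b⟩ h
    rfl

end PiAntidiag

theorem coeff_pow_eq_zero {R : Type*} [Ring R] {B : PowerSeries R} (hB : PowerSeries.coeff 0 B = 0)
    (m : ℕ) : ∀ k < m, PowerSeries.coeff k (B ^ m) = 0 := by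
  induction m with
  | zero => intro k hk; omega
  | succ m ih =>
    intro k hk
    rw [pow_succ, PowerSeries.coeff_mul]
    refine Finset.sum_eq_zero fun ij hij => ?_
    rw [mem_antidiagonal] at hij
    rcases Nat.eq_zero_or_pos ij.2 with h | h
    · rw [h, hB, mul_zero]
    · rw [ih _ (by omega), zero_mul]

/-! ### `ρ_{exp B} = exp ρ̂_B` at a point -/

section PullbackExp
variable {E : Type*} [NormedAddCommGroup E] [NormedSpace ℝ E] {p : ℕ}

/-- The coefficient of `t^k` in `ρ̂_{B(t)}^m φ`. -/
def infActionPow (B : PowerSeries (E →L[ℝ] E)) : ℕ → ℕ → E [⋀^Fin p]→L[ℝ] ℝ → E [⋀^Fin p]→L[ℝ] ℝ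
  | 0 => fun k φ => if k = 0 then φ else 0
  | m + 1 => fun k φ => ∑ ij ∈ antidiagonal k,
      infAction (PowerSeries.coeff ij.1 B) (infActionPow B m ij.2 φ)

theorem infActionPow_eq_zero {B : PowerSeries (E →L[ℝ] E)} (hB : PowerSeries.coeff 0 B = 0)
    (φ : E [⋀^Fin p]→L[ℝ] ℝ) (m : ℕ) : ∀ k < m, infActionPow B m k φ = 0 := by
  induction m with
  | zero => intro k hk; omega
  | succ m ih =>
    intro k hk
    refine Finset.sum_eq_zero fun ij hij => ?_
    rw [mem_antidiagonal] at hij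
    rcases Nat.eq_zero_or_pos ij.1 with h | h
    · rw [h, hB, infAction_zero_left]
    · rw [ih _ (by omega), infAction_zero]

/-- The coefficient of `t^j` in the truncation `∑_{l ≤ K} (s^l / l!) B(t)^l` of `exp (s B(t))`. -/
def expCoeff (B : PowerSeries (E →L[ℝ] E)) (K : ℕ) (s : ℝ) (j : ℕ) : E →L[ℝ] E :=
  ∑ l ∈ Finset.range (K + 1), (s ^ l * (l.factorial : ℝ)⁻¹) • PowerSeries.coeff j (B ^ l)

theorem hasDerivAt_sum_pow_div_factorial {F : Type*} [NormedAddCommGroup F] [NormedSpace ℝ F]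
    (K : ℕ) (x : ℕ → F) (s : ℝ) :
    HasDerivAt (fun s : ℝ => ∑ l ∈ Finset.range (K + 1), (s ^ l * (l.factorial : ℝ)⁻¹) • x l)
      (∑ l ∈ Finset.range K, (s ^ l * (l.factorial : ℝ)⁻¹) • x (l + 1)) s := by
  have h (l : ℕ) : HasDerivAt (fun s : ℝ => (s ^ (l + 1) * ((l + 1).factorial : ℝ)⁻¹) • x (l + 1))
      ((s ^ l * (l.factorial : ℝ)⁻¹) • x (l + 1)) s := by
    refine HasDerivAt.smul_const ?_ _
    convert (hasDerivAt_pow (l + 1) s).mul_const ((l + 1).factorial : ℝ)⁻¹ using 1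
    rw [Nat.factorial_succ]
    have : (l.factorial : ℝ) ≠ 0 := Nat.cast_ne_zero.2 l.factorial_ne_zero
    push_cast
    field_simp
  have h' := (HasDerivAt.fun_sum fun l (_ : l ∈ Finset.range K) => h l).add_const
    ((s ^ 0 * ((0 : ℕ).factorial : ℝ)⁻¹) • x 0)
  refine h'.congr_of_eventuallyEq (Filter.Eventually.of_forall fun s => ?_)
  simp only [Finset.sum_range_succ', pow_zero]

/-- This is `(e^{sB})' = e^{sB} B`. The truncation loses only `B^{K+1}`, which has no terms of
degree at most `K`. -/
theorem hasDerivAt_expCoeff {B : PowerSeries (E →L[ℝ] E)} (hB : PowerSeries.coeff 0 B = 0)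
    {K j : ℕ} (hj : j ≤ K) (s : ℝ) :
    HasDerivAt (fun s => expCoeff B K s j)
      (∑ ab ∈ antidiagonal j, expCoeff B K s ab.1 * PowerSeries.coeff ab.2 B) s := by
  refine (hasDerivAt_sum_pow_div_factorial K (fun l => PowerSeries.coeff j (B ^ l)) s).congr_deriv ?_
  simp only [pow_succ, PowerSeries.coeff_mul, Finset.smul_sum, expCoeff, Finset.sum_mul]
  rw [Finset.sum_comm]
  refine Finset.sum_congr rfl fun ab hab => ?_
  rw [mem_antidiagonal] at hab
  rw [Finset.sum_range_succ]
  have : PowerSeries.coeff ab.1 (B ^ K) * PowerSeries.coeff ab.2 B = 0 := by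
    rcases Nat.eq_zero_or_pos ab.2 with h | h
    · rw [h, hB, mul_zero]
    · rw [coeff_pow_eq_zero hB _ _ (by omega), zero_mul]
  simp only [smul_mul_assoc, this, smul_zero, add_zero]

theorem pullbackCoeff_update (g : ℕ → E →L[ℝ] E) (k : ℕ) (φ : E [⋀^Fin p]→L[ℝ] ℝ)
    (u : Fin p → E) (l : Fin p) (b : E →L[ℝ] E) :
    pullbackCoeff g k φ (Function.update u l (b (u l))) =
      ∑ c ∈ Finset.piAntidiag Finset.univ k,
        φ (Function.update (fun i => g (c i) (u i)) l (g (c l) (b (u l)))) := by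
  rw [pullbackCoeff_apply]
  refine Finset.sum_congr rfl fun c _ => congrArg φ (funext fun i => ?_)
  rcases eq_or_ne i l with rfl | h
  · simp
  · simp [Function.update_of_ne h]

/-- The product rule differentiates one slot at a time, and `(e^{sB})' = e^{sB} B` puts `B` directly
on the argument `u_l`. Summed over `l` this is `ρ̂_B` applied to the pulled-back form. -/
theorem hasDerivAt_pullbackCoeff_expCoeff {B : PowerSeries (E →L[ℝ] E)}
    (hB : PowerSeries.coeff 0 B = 0) {K k : ℕ} (hk : k ≤ K) (φ : E [⋀^Fin p]→L[ℝ] ℝ)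
    (u : Fin p → E) (s : ℝ) :
    HasDerivAt (fun s => pullbackCoeff (expCoeff B K s) k φ u)
      (∑ ij ∈ antidiagonal k,
        infAction (PowerSeries.coeff ij.1 B) (pullbackCoeff (expCoeff B K s) ij.2 φ) u) s := by
  simp only [pullbackCoeff_apply]
  have h (c : Fin p → ℕ) (hc : c ∈ Finset.piAntidiag Finset.univ k) :
      HasDerivAt (fun s => φ fun i => expCoeff B K s (c i) (u i))
        (∑ l, φ (Function.update (fun i => expCoeff B K s (c i) (u i)) l
          (∑ ab ∈ antidiagonal (c l),
            expCoeff B K s ab.1 (PowerSeries.coeff ab.2 B (u l))))) s := by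
    have hle (i : Fin p) : c i ≤ K := by
      rw [Finset.mem_piAntidiag] at hc
      exact (Finset.single_le_sum (fun _ _ => Nat.zero_le _) (Finset.mem_univ i)).trans
        (hc.1.le.trans hk)
    have hi (i : Fin p) : HasDerivAt (fun s => expCoeff B K s (c i) (u i))
        (∑ ab ∈ antidiagonal (c i),
            expCoeff B K s ab.1 (PowerSeries.coeff ab.2 B (u i))) s := by
      refine ((hasDerivAt_expCoeff hB (hle i) s).clm_apply (hasDerivAt_const s (u i))).congr_deriv ?_
      simp
    have := (φ.toContinuousMultilinearMap.hasFDerivAt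
      (fun i => expCoeff B K s (c i) (u i))).comp_hasDerivAt s (hasDerivAt_pi.2 hi)
    refine this.congr_deriv ?_
    simp [ContinuousMultilinearMap.linearDeriv_apply]
  refine (HasDerivAt.fun_sum h).congr_deriv ?_
  simp only [infAction_apply, pullbackCoeff_update]
  refine Finset.sum_comm.trans ((Finset.sum_congr rfl fun l _ => ?_).trans Finset.sum_comm)
  rw [← sum_piAntidiag_antidiagonal k l (fun c b => φ (Function.update
    (fun i => expCoeff B K s (c i) (u i)) l
      (expCoeff B K s (c l) (PowerSeries.coeff b B (u l)))))]
  refine Finset.sum_congr rfl fun c _ => ?_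
  have := φ.toMultilinearMap.map_update_sum (antidiagonal (c l)) l
    (fun ab => expCoeff B K s ab.1 (PowerSeries.coeff ab.2 B (u l)))
    (fun i => expCoeff B K s (c i) (u i))
  refine this.trans (Finset.sum_congr rfl fun ab _ => congrArg φ (funext fun i => ?_))
  rcases eq_or_ne i l with rfl | h
  · simp
  · simp [Function.update_of_ne h]

/-- The coefficient of `t^k` in the truncation `∑_{m ≤ K} (s^m / m!) ρ̂_{B(t)}^m φ`. -/
def expInfAction (B : PowerSeries (E →L[ℝ] E)) (K : ℕ) (s : ℝ) (k : ℕ) (φ : E [⋀^Fin p]→L[ℝ] ℝ) :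
    E [⋀^Fin p]→L[ℝ] ℝ :=
  ∑ m ∈ Finset.range (K + 1), (s ^ m * (m.factorial : ℝ)⁻¹) • infActionPow B m k φ

theorem hasDerivAt_expInfAction {B : PowerSeries (E →L[ℝ] E)} (hB : PowerSeries.coeff 0 B = 0)
    {K k : ℕ} (hk : k ≤ K) (φ : E [⋀^Fin p]→L[ℝ] ℝ) (s : ℝ) :
    HasDerivAt (fun s => expInfAction B K s k φ)
      (∑ ij ∈ antidiagonal k,
        infAction (PowerSeries.coeff ij.1 B) (expInfAction B K s ij.2 φ)) s := by
  refine (hasDerivAt_sum_pow_div_factorial K (fun m => infActionPow B m k φ) s).congr_deriv ?_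
  have hsum (b : E →L[ℝ] E) (j : ℕ) : infAction b (expInfAction B K s j φ) =
      ∑ m ∈ Finset.range (K + 1), (s ^ m * (m.factorial : ℝ)⁻¹) •
        infAction b (infActionPow B m j φ) := by
    have := map_sum ((infActionCLM E p).flip b) (fun m => (s ^ m * (m.factorial : ℝ)⁻¹) •
      infActionPow B m j φ) (Finset.range (K + 1))
    refine this.trans (Finset.sum_congr rfl fun m _ => ?_)
    rw [map_smul]
    rfl
  simp only [hsum, infActionPow, Finset.smul_sum]
  rw [Finset.sum_comm]
  refine Finset.sum_congr rfl fun ij hij => ?_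
  rw [mem_antidiagonal] at hij
  rw [Finset.sum_range_succ, left_eq_add]
  rcases Nat.eq_zero_or_pos ij.1 with h | h
  · rw [h, hB, infAction_zero_left, smul_zero]
  · rw [infActionPow_eq_zero hB _ _ _ (by omega), infAction_zero, smul_zero]

theorem expCoeff_zero (B : PowerSeries (E →L[ℝ] E)) (K j : ℕ) :
    expCoeff B K 0 j = if j = 0 then 1 else 0 := by
  rw [expCoeff, Finset.sum_eq_single 0]
  · simp [PowerSeries.coeff_one]
  · intro l _ hl; simp [hl]
  · simp

theorem expInfAction_zero (B : PowerSeries (E →L[ℝ] E)) (K k : ℕ) (φ : E [⋀^Fin p]→L[ℝ] ℝ) :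
    expInfAction B K 0 k φ = if k = 0 then φ else 0 := by
  rw [expInfAction, Finset.sum_eq_single 0]
  · simp [infActionPow]
  · intro l _ hl; simp [hl]
  · simp

theorem pullbackCoeff_expCoeff_zero (B : PowerSeries (E →L[ℝ] E)) (K k : ℕ)
    (φ : E [⋀^Fin p]→L[ℝ] ℝ) :
    pullbackCoeff (expCoeff B K 0) k φ = if k = 0 then φ else 0 := by
  ext u
  rw [pullbackCoeff_apply]
  rcases eq_or_ne k 0 with rfl | hk
  · simp [Finset.piAntidiag_zero, expCoeff_zero]
  · rw [if_neg hk]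
    refine Finset.sum_eq_zero fun c hc => ?_
    rw [Finset.mem_piAntidiag] at hc
    obtain ⟨i, -, hi⟩ := Finset.exists_ne_zero_of_sum_ne_zero (hc.1.trans_ne hk)
    exact φ.map_coord_zero i (by simp [expCoeff_zero, hi])

/-- Both sides satisfy `y' = ρ̂_B y` in the auxiliary parameter `s`, with the same value at `s = 0`.
As `B` has no constant term, the derivative of the coefficient of degree `k` involves only lower
coefficients, so induction on `k` shows that the difference is constant. -/
theorem pullbackCoeff_expCoeff {B : PowerSeries (E →L[ℝ] E)} (hB : PowerSeries.coeff 0 B = 0)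
    (K : ℕ) (φ : E [⋀^Fin p]→L[ℝ] ℝ) (k : ℕ) : k ≤ K → ∀ s,
    pullbackCoeff (expCoeff B K s) k φ = expInfAction B K s k φ := by
  induction k using Nat.strong_induction_on with
  | _ k ih =>
  intro hk s
  ext u
  have hG (s : ℝ) := (((ContinuousAlternatingMap.apply ℝ E ℝ u).hasFDerivAt).comp_hasDerivAt s
    (hasDerivAt_expInfAction hB hk φ s))
  have hd (s : ℝ) := (hasDerivAt_pullbackCoeff_expCoeff hB hk φ u s).sub (hG s)
  have hd0 (s : ℝ) : deriv (fun s => pullbackCoeff (expCoeff B K s) k φ u -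
      expInfAction B K s k φ u) s = 0 := by
    refine (hd s).deriv.trans ?_
    rw [sub_eq_zero, map_sum]
    refine Finset.sum_congr rfl fun ij hij => ?_
    rw [mem_antidiagonal] at hij
    rcases Nat.eq_zero_or_pos ij.1 with h | h
    · rw [h, hB, infAction_zero_left, infAction_zero_left]
      rfl
    · rw [ih _ (by omega) (by omega)]
      rfl
  have hc : pullbackCoeff (expCoeff B K s) k φ u - expInfAction B K s k φ u =
      pullbackCoeff (expCoeff B K 0) k φ u - expInfAction B K 0 k φ u :=
    is_const_of_deriv_eq_zero (fun s => (hd s).differentiableAt) hd0 s 0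
  simp only [pullbackCoeff_expCoeff_zero, expInfAction_zero, sub_self] at hc
  exact sub_eq_zero.1 hc

end PullbackExp

/-! ### The identity `d e^r = e^r (e^{-ad_r} d)` for power series over a ring -/

section OperatorExp
variable {R : Type*} [Ring R]

theorem coeff_mul_eq_zero {P Q : PowerSeries R} {m l : ℕ} (hP : ∀ k < m, PowerSeries.coeff k P = 0)
    (hQ : ∀ k < l, PowerSeries.coeff k Q = 0) : ∀ k < m + l, PowerSeries.coeff k (P * Q) = 0 := by
  intro k hk
  rw [PowerSeries.coeff_mul]
  refine Finset.sum_eq_zero fun ij hij => ?_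
  rw [mem_antidiagonal] at hij
  rcases lt_or_ge ij.1 m with h | h
  · rw [hP _ h, zero_mul]
  · rw [hQ _ (by omega), mul_zero]

variable [Algebra ℝ R]

/-- The commutator with `r`. -/
def adEnd (r : R) : Module.End ℝ R := LinearMap.mulLeft ℝ r - LinearMap.mulRight ℝ r

theorem adEnd_apply (r P : R) : adEnd r P = r * P - P * r := rfl

theorem neg_adEnd_pow_apply (r D : R) (m : ℕ) :
    ((-adEnd r) ^ m) D = (-1 : ℝ) ^ m • (adEnd r ^ m) D := by
  induction m with
  | zero => simp
  | succ m ih =>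
    rw [pow_succ', Module.End.mul_apply, ih, map_smul, LinearMap.neg_apply, pow_succ' (adEnd r),
      Module.End.mul_apply, pow_succ, mul_neg_one, neg_smul, smul_neg]

/-- Right multiplication by `r` is left multiplication minus `ad_r`, and these commute; this is the
binomial theorem for them. -/
theorem mul_pow_eq_sum_adEnd (r D : R) (m : ℕ) :
    D * r ^ m = ∑ ij ∈ antidiagonal m, m.choose ij.1 • (r ^ ij.1 * ((-adEnd r) ^ ij.2) D) := by
  have hc : Commute (LinearMap.mulLeft ℝ r) (-adEnd r) := by
    refine Commute.neg_right (Commute.sub_right (Commute.refl _) ?_)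
    exact LinearMap.commute_mulLeft_right r r
  have h := hc.add_pow' m
  have e : LinearMap.mulLeft ℝ r + -adEnd r = LinearMap.mulRight ℝ r := by
    rw [adEnd]; abel
  rw [e, LinearMap.pow_mulRight] at h
  have h' := congrArg (fun f => f D) h
  simpa [LinearMap.pow_mulLeft] using h'

theorem mul_exp_term_eq_sum (r D : R) (m : ℕ) :
    D * ((m.factorial : ℝ)⁻¹ • r ^ m) = ∑ i ∈ Finset.range (m + 1),
      ((i.factorial : ℝ)⁻¹ • r ^ i) *
        (((m - i).factorial : ℝ)⁻¹ • ((-adEnd r) ^ (m - i)) D) := by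
  rw [mul_smul_comm, mul_pow_eq_sum_adEnd, Finset.smul_sum,
    Finset.Nat.sum_antidiagonal_eq_sum_range_succ_mk]
  refine Finset.sum_congr rfl fun i hi => ?_
  have hi' : i ≤ m := Nat.lt_succ_iff.1 (Finset.mem_range.1 hi)
  rw [smul_mul_smul_comm, ← Nat.cast_smul_eq_nsmul ℝ, smul_smul]
  congr 1
  rw [Nat.cast_choose ℝ hi']
  have : (m.factorial : ℝ) ≠ 0 := Nat.cast_ne_zero.2 m.factorial_ne_zero
  field_simp

theorem coeff_adEnd_pow_eq_zero {r : PowerSeries R} (hr : PowerSeries.coeff 0 r = 0)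
    (D : PowerSeries R) (m : ℕ) : ∀ k < m, PowerSeries.coeff k (((-adEnd r) ^ m) D) = 0 := by
  induction m with
  | zero => intro k hk; omega
  | succ m ih =>
    intro k hk
    have hr' : ∀ k < 1, PowerSeries.coeff k r = 0 := by
      intro k hk; rwa [Nat.lt_one_iff.1 hk]
    rw [pow_succ', Module.End.mul_apply, LinearMap.neg_apply, adEnd_apply, map_neg, map_sub,
      coeff_mul_eq_zero hr' ih k (by omega), coeff_mul_eq_zero ih hr' k hk, sub_zero, neg_zero]

/-- The truncation `∑_{m ≤ K} (1/m!) r^m`. -/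
def truncExp (r : PowerSeries R) (K : ℕ) : PowerSeries R :=
  ∑ m ∈ Finset.range (K + 1), (m.factorial : ℝ)⁻¹ • r ^ m

/-- The truncation `∑_{m ≤ K} (1/m!) (-ad_r)^m D`. -/
def truncExpAd (r D : PowerSeries R) (K : ℕ) : PowerSeries R :=
  ∑ m ∈ Finset.range (K + 1), (m.factorial : ℝ)⁻¹ • ((-adEnd r) ^ m) D

/-- Dividing the binomial identity by `m!` turns it into a Cauchy product. -/
theorem coeff_mul_truncExp {r : PowerSeries R} (hr : PowerSeries.coeff 0 r = 0)
    (D : PowerSeries R) {k K : ℕ} (hk : k ≤ K) :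
    PowerSeries.coeff k (D * truncExp r K) =
      PowerSeries.coeff k (truncExp r K * truncExpAd r D K) := by
  rw [truncExp, Finset.mul_sum]
  simp only [mul_exp_term_eq_sum]
  rw [Finset.sum_range_diag_flip (K + 1) fun i j => ((i.factorial : ℝ)⁻¹ • r ^ i) *
        ((j.factorial : ℝ)⁻¹ • ((-adEnd r) ^ j) D), truncExpAd, Finset.sum_mul, map_sum, map_sum]
  refine Finset.sum_congr rfl fun i _ => ?_
  rw [Finset.mul_sum, map_sum, map_sum]
  -- The product of the truncations has additional terms with `i + j > K`, all of order at least `i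
  -- + j > k`.
  refine Finset.sum_subset (Finset.range_mono (by omega)) fun j _ hj => ?_
  rw [Finset.mem_range] at hj
  rw [smul_mul_smul_comm, PowerSeries.coeff_smul, coeff_mul_eq_zero (coeff_pow_eq_zero hr i)
    (coeff_adEnd_pow_eq_zero hr D j) k (by omega), smul_zero]

theorem coeff_zero_truncExp {r : PowerSeries R} (hr : PowerSeries.coeff 0 r = 0) (K : ℕ) :
    PowerSeries.coeff 0 (truncExp r K) = 1 := by
  rw [truncExp, map_sum, Finset.sum_eq_single 0]
  · simp
  · intro m _ hm
    rw [PowerSeries.coeff_smul, coeff_pow_eq_zero hr m 0 (by omega), smul_zero]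
  · simp

/-- If `D e^r v` vanishes in degrees less than `k`, then `D e^r v` and `(e^{-ad_r} D) v` agree up to
degree `k`. -/
theorem truncExpAd_smul_eq {H : Type*} [AddCommGroup H] [Module R H] {r : PowerSeries R}
    (hr : PowerSeries.coeff 0 r = 0) (d : R) {k K : ℕ} (hk : k ≤ K) (v : H)
    (hv : ∀ j < k, d • PowerSeries.coeff j (truncExp r K) • v = 0) :
    PowerSeries.coeff k (truncExpAd r (PowerSeries.C d) K) • v =
      d • PowerSeries.coeff k (truncExp r K) • v := by
  induction k using Nat.strong_induction_on with
  | _ k ih =>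
  have h := congrArg (· • v) (coeff_mul_truncExp hr (PowerSeries.C d) hk)
  simp only [PowerSeries.coeff_C_mul] at h
  simp only [PowerSeries.coeff_mul, Finset.sum_smul, mul_smul] at h
  -- By induction the lower coefficients of `(e^{-ad_r} d) v` equal those of `d e^r v`, which
  -- vanish. Only the constant term 1 of `e^r` remains.
  rw [h, Finset.sum_eq_single (0, k), coeff_zero_truncExp hr, one_smul]
  · rintro ⟨i, j⟩ hij hne
    rw [mem_antidiagonal] at hij
    have hj : j < k := by
      by_contra hc
      exact hne (Prod.ext (by simp only at hij ⊢; omega) (by simp only at hij ⊢; omega))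
    rw [ih j hj (by omega) fun j' hj' => hv j' (by omega), hv j hj, smul_zero]
  · intro hn
    exact absurd (mem_antidiagonal.2 (zero_add k)) hn

end OperatorExp

/-! ### `ρ_{exp A} = exp ρ̂_A` for fields of endomorphisms -/

section FieldExp
variable {n : ℕ} {X : Type*} [TopologicalSpace X] [ChartedSpace (Model n) X]
  [IsManifold (𝓡 n) ∞ X] {p : ℕ}

/-- Evaluation of fields of endomorphisms at a point, as a ring homomorphism. -/
def EndField.valHom (x : X) : EndField n X →+* (Model n →L[ℝ] Model n) where
  toFun a := a.val x
  map_one' := rfl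
  map_mul' _ _ := rfl
  map_zero' := rfl
  map_add' _ _ := rfl

theorem EndField.val_sum {ι : Type*} (s : Finset ι) (c : ι → ℝ) (a : ι → EndField n X) (x : X) :
    EndField.val (∑ i ∈ s, c i • a i) x = ∑ i ∈ s, c i • EndField.val (a i) x :=
  map_sum (EndField.valHom x) _ _

theorem rhoHatPow_apply (A : PowerSeries (EndField n X)) (m k : ℕ) (η : FormField n X p) (x : X) :
    rhoHatPow A m k η x = infActionPow (A.map (EndField.valHom x)) m k (η x) := by
  induction m generalizing k with
  | zero =>
    change (if k = 0 then η else 0) x = if k = 0 then η x else 0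
    split_ifs <;> rfl
  | succ m ih =>
    change (∑ ij ∈ antidiagonal k, rhoHat (PowerSeries.coeff ij.1 A) (rhoHatPow A m ij.2 η)) x =
      ∑ ij ∈ antidiagonal k, _
    rw [Finset.sum_apply]
    refine Finset.sum_congr rfl fun ij _ => ?_
    rw [rhoHat, ih, PowerSeries.coeff_map]
    rfl

theorem rhoHatPow_eq_zero {A : PowerSeries (EndField n X)} (hA : PowerSeries.coeff 0 A = 0)
    (η : FormField n X p) {m k : ℕ} (h : k < m) : rhoHatPow A m k η = 0 := by
  funext x
  rw [rhoHatPow_apply]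
  exact infActionPow_eq_zero (by rw [PowerSeries.coeff_map, hA, map_zero]) _ _ _ h

/-- `ρ_{exp A} = exp ρ̂_A`. -/
theorem gaugeAction_expSeries {A : PowerSeries (EndField n X)} (hA : PowerSeries.coeff 0 A = 0)
    {k K : ℕ} (hk : k ≤ K) (η : FormField n X p) :
    gaugeAction (expSeries A) k η =
      ∑ m ∈ Finset.range (K + 1), (m.factorial : ℝ)⁻¹ • rhoHatPow A m k η := by
  funext x
  have hB : PowerSeries.coeff 0 (A.map (EndField.valHom x)) = 0 := by
    rw [PowerSeries.coeff_map, hA, map_zero]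
  have h := pullbackCoeff_expCoeff hB K (η x) k hk 1
  have hr : expInfAction (A.map (EndField.valHom x)) K 1 k (η x) =
      (∑ m ∈ Finset.range (K + 1), (m.factorial : ℝ)⁻¹ • rhoHatPow A m k η) x := by
    rw [Finset.sum_apply, expInfAction]
    refine Finset.sum_congr rfl fun m _ => ?_
    rw [Pi.smul_apply, rhoHatPow_apply, one_pow, one_mul]
  rw [← hr, ← h]
  ext u
  rw [gaugeAction, pullbackCoeff_apply, pullbackCoeff_apply]
  refine Finset.sum_congr rfl fun c hc => congrArg (η x) (funext fun i => ?_)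
  have hi : c i ≤ K := by
    rw [Finset.mem_piAntidiag] at hc
    exact (Finset.single_le_sum (fun _ _ => Nat.zero_le _) (Finset.mem_univ i)).trans
      (hc.1.le.trans hk)
  congr 1
  rw [expSeries, PowerSeries.coeff_mk, EndField.val_sum, expCoeff]
  have hterm (l : ℕ) : (1 ^ l * (l.factorial : ℝ)⁻¹) •
      PowerSeries.coeff (c i) (A.map (EndField.valHom x) ^ l) =
      (l.factorial : ℝ)⁻¹ • EndField.val (PowerSeries.coeff (c i) (A ^ l)) x := by
    rw [one_pow, one_mul, ← map_pow, PowerSeries.coeff_map]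
    rfl
  simp only [hterm]
  -- `expSeries` stops at the power `c i`, `expCoeff` at `K`; the powers in between have no
  -- coefficient in degree `c i`.
  refine Finset.sum_subset (Finset.range_mono (by omega)) fun l _ hl => ?_
  rw [Finset.mem_range] at hl
  rw [coeff_pow_eq_zero hA l _ (by omega)]
  exact smul_zero (A := Model n →L[ℝ] Model n) (l.factorial : ℝ)⁻¹

theorem IsSmoothForm.rhoHatPow {η : FormField n X p} (hη : IsSmoothForm η)
    (A : PowerSeries (EndField n X)) (m k : ℕ) : IsSmoothForm (rhoHatPow A m k η) := by
  induction m generalizing k with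
  | zero =>
    change IsSmoothForm (if k = 0 then η else 0)
    split_ifs
    exacts [hη, isSmoothForm_zero]
  | succ m ih => exact IsSmoothForm.sum fun ij _ => (ih ij.2).rhoHat _

end FieldExp

/-! ### Linear operators on smooth forms -/

section Operators
variable {n : ℕ} {X : Type*} [TopologicalSpace X] [ChartedSpace (Model n) X] {p : ℕ}

variable (n X p) in
/-- The space of smooth `p`-forms. -/
def smoothForms : Submodule ℝ (FormField n X p) where
  carrier := {η | IsSmoothForm η}
  add_mem' := IsSmoothForm.add
  zero_mem' := isSmoothForm_zero
  smul_mem' c _ h := h.const_smul c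

variable (n X p) in
/-- The type of smooth `p`-forms. -/
def SmoothForm : Type _ := smoothForms n X p

instance : AddCommGroup (SmoothForm n X p) := inferInstanceAs (AddCommGroup (smoothForms n X p))

instance : Module ℝ (SmoothForm n X p) := inferInstanceAs (Module ℝ (smoothForms n X p))

/-- The form underlying a smooth form. -/
def SmoothForm.toField : SmoothForm n X p →ₗ[ℝ] FormField n X p := (smoothForms n X p).subtype

theorem SmoothForm.isSmoothForm (η : SmoothForm n X p) : IsSmoothForm η.toField := η.2

theorem SmoothForm.ext {η θ : SmoothForm n X p} (h : η.toField = θ.toField) : η = θ :=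
  Subtype.ext h

/-- A smooth form as an element of the space of smooth forms. -/
def IsSmoothForm.toSmoothForm {η : FormField n X p} (hη : IsSmoothForm η) : SmoothForm n X p :=
  ⟨η, hη⟩

variable [IsManifold (𝓡 n) ∞ X]

theorem rhoHat_add (b : EndField n X) (η θ : FormField n X p) :
    rhoHat b (η + θ) = rhoHat b η + rhoHat b θ := funext fun _ => infAction_add _ _ _

theorem rhoHat_smul (b : EndField n X) (c : ℝ) (η : FormField n X p) :
    rhoHat b (c • η) = c • rhoHat b η := funext fun _ => infAction_smul _ _ _

theorem rhoHat_smul_left (c : ℝ) (b : EndField n X) (η : FormField n X p) :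
    rhoHat (c • b) η = c • rhoHat b η := funext fun _ => infAction_smul_left _ _ _

theorem rhoHat_add_left (b b' : EndField n X) (η : FormField n X p) :
    rhoHat (b + b') η = rhoHat b η + rhoHat b' η := funext fun _ => infAction_add_left _ _ _

theorem rhoHat_zero (b : EndField n X) : rhoHat b (0 : FormField n X p) = 0 :=
  funext fun _ => infAction_zero _

theorem rhoHat_zero_left (η : FormField n X p) : rhoHat (0 : EndField n X) η = 0 :=
  funext fun _ => infAction_zero_left _

theorem lieOp_add_left (b b' : EndField n X) {η : FormField n X p} (hη : IsSmoothForm η) :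
    lieOp (b + b') η = lieOp b η + lieOp b' η := by
  rw [lieOp, rhoHat_add_left, rhoHat_add_left, extD_add (hη.rhoHat b) (hη.rhoHat b'), lieOp, lieOp]
  abel

theorem lieOp_zero_left (η : FormField n X p) : lieOp (0 : EndField n X) η = 0 := by
  rw [lieOp, rhoHat_zero_left, rhoHat_zero_left, extD_zero, sub_zero]

theorem lieOp_sum_left {ι : Type*} (s : Finset ι) (b : ι → EndField n X) {η : FormField n X p}
    (hη : IsSmoothForm η) : lieOp (∑ i ∈ s, b i) η = ∑ i ∈ s, lieOp (b i) η := by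
  classical
  induction s using Finset.induction_on with
  | empty => simp [lieOp_zero_left]
  | insert i s hi ih => rw [Finset.sum_insert hi, Finset.sum_insert hi, lieOp_add_left _ _ hη, ih]

/-- `ρ̂_b` as a linear operator on smooth forms. -/
def rhoHatLin (b : EndField n X) : SmoothForm n X p →ₗ[ℝ] SmoothForm n X p where
  toFun η := (η.isSmoothForm.rhoHat b).toSmoothForm
  map_add' η θ := SmoothForm.ext (rhoHat_add b η.toField θ.toField)
  map_smul' c η := SmoothForm.ext (rhoHat_smul b c η.toField)

variable (n X p) in
/-- `d` as a linear operator on smooth forms. -/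
def extDLin : SmoothForm n X p →ₗ[ℝ] SmoothForm n X (p + 1) where
  toFun η := η.isSmoothForm.extD.toSmoothForm
  map_add' η θ := SmoothForm.ext (extD_add η.isSmoothForm θ.isSmoothForm)
  map_smul' c η := SmoothForm.ext (extD_smul c η.toField)

end Operators

/-! ### Power series of operators and the formula for the obstruction -/

section OperatorSeries
variable {n : ℕ} {X : Type*} [TopologicalSpace X] [ChartedSpace (Model n) X]
  [IsManifold (𝓡 n) ∞ X] {p : ℕ}

variable (n X p) in
/-- The ring of operators on smooth forms of degree `p` and `p + 1`. -/
abbrev FormOp : Type _ := Module.End ℝ (SmoothForm n X p × SmoothForm n X (p + 1))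

/-- `ρ̂_b`, acting on forms of degree `p` and `p + 1`. -/
def rhoHatOp (b : EndField n X) : FormOp n X p := (rhoHatLin b).prodMap (rhoHatLin b)

variable (n X p) in
/-- `d`, acting on forms of degree `p` and `p + 1` as `(η, θ) ↦ (0, dη)`. -/
def extDOp : FormOp n X p :=
  LinearMap.inr ℝ _ _ ∘ₗ extDLin n X p ∘ₗ LinearMap.fst ℝ _ _

/-- `ρ̂_{A(t)}` as a power series of operators. -/
def rhoHatSeries (A : PowerSeries (EndField n X)) : PowerSeries (FormOp n X p) :=
  PowerSeries.mk fun k => rhoHatOp (PowerSeries.coeff k A)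

theorem coeff_zero_rhoHatSeries {A : PowerSeries (EndField n X)} (hA : PowerSeries.coeff 0 A = 0) :
    PowerSeries.coeff 0 (rhoHatSeries A : PowerSeries (FormOp n X p)) = 0 := by
  rw [rhoHatSeries, PowerSeries.coeff_mk, hA]
  refine LinearMap.ext fun q => Prod.ext (SmoothForm.ext ?_) (SmoothForm.ext ?_)
  · exact rhoHat_zero_left _
  · exact rhoHat_zero_left _

theorem coeff_rhoHatSeries_pow (A : PowerSeries (EndField n X)) (m k : ℕ)
    (q : SmoothForm n X p × SmoothForm n X (p + 1)) :
    (PowerSeries.coeff k (rhoHatSeries A ^ m) q).1.toField = rhoHatPow A m k q.1.toField := by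
  induction m generalizing k with
  | zero =>
    rw [pow_zero, PowerSeries.coeff_one]
    change _ = if k = 0 then q.1.toField else 0
    split_ifs <;> rfl
  | succ m ih =>
    rw [pow_succ', PowerSeries.coeff_mul, LinearMap.sum_apply, Prod.fst_sum, map_sum SmoothForm.toField]
    refine Finset.sum_congr rfl fun ij _ => ?_
    rw [← ih, rhoHatSeries, PowerSeries.coeff_mk]
    rfl

/-- `P̂`, acting on smooth forms of degree `p` and `p + 1`, is the series of operators `P`. -/
def Represents (Q : PowerSeries (FormOp n X p)) (P : OpSeries n X p (p + 1)) : Prop :=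
  ∀ k q, (PowerSeries.coeff k Q q).2.toField = P k q.1.toField

theorem Represents.adRho {Q : PowerSeries (FormOp n X p)} {P : OpSeries n X p (p + 1)}
    (h : Represents Q P) (A : PowerSeries (EndField n X)) :
    Represents (adEnd (rhoHatSeries A) Q) (adRho A P) := by
  intro k q
  -- `adRho` indexes both products by the degree of `A` first, whereas in `Q * ρ̂_A` it comes
  -- second; hence the swap.
  rw [adEnd_apply, map_sub, PowerSeries.coeff_mul, PowerSeries.coeff_mul,
    ← Finset.Nat.sum_antidiagonal_swap (n := k) 
      (f := fun ij => PowerSeries.coeff ij.1 Q * PowerSeries.coeff ij.2 (rhoHatSeries A)),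
    ← Finset.sum_sub_distrib, LinearMap.sum_apply,
    Prod.snd_sum, map_sum SmoothForm.toField]
  refine Finset.sum_congr rfl fun ij _ => ?_
  have h1 : ((PowerSeries.coeff ij.1 (rhoHatSeries A) * PowerSeries.coeff ij.2 Q : FormOp n X p) q).2.toField =
      rhoHat (PowerSeries.coeff ij.1 A) (P ij.2 q.1.toField) := by
    rw [← h, rhoHatSeries, PowerSeries.coeff_mk]
    rfl
  have h2 : ((PowerSeries.coeff ij.2 Q * PowerSeries.coeff ij.1 (rhoHatSeries A) : FormOp n X p) q).2.toField =
      P ij.2 (rhoHat (PowerSeries.coeff ij.1 A) q.1.toField) := by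
    rw [Module.End.mul_apply, h, rhoHatSeries, PowerSeries.coeff_mk]
    rfl
  rw [← h1, ← h2, ← map_sub]
  rfl

theorem represents_lieOp (A : PowerSeries (EndField n X)) :
    Represents (adEnd (rhoHatSeries A) (PowerSeries.C (extDOp n X p)))
      (fun k => lieOp (PowerSeries.coeff k A)) := by
  intro k q
  rw [adEnd_apply, map_sub, PowerSeries.coeff_C_mul, PowerSeries.coeff_mul_C, rhoHatSeries,
    PowerSeries.coeff_mk]
  rfl

/-- Coefficientwise this is `[ρ̂_a, L_b] = L_{ba} - i_{N(a,b)}`, summed to `[ρ̂_A, [ρ̂_A, d]] =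
L_{A²} - i_{N(A,A)} = -G(A,A)`. -/
theorem represents_neg_GSeries (A : PowerSeries (EndField n X)) :
    Represents (-(adEnd (rhoHatSeries A) ^ 2) (PowerSeries.C (extDOp n X p))) (GSeries A) := by
  intro k q
  have h := (represents_lieOp (p := p) A).adRho A k q
  rw [pow_two, Module.End.mul_apply, map_neg, LinearMap.neg_apply, Prod.snd_neg, map_neg SmoothForm.toField,
    h, GSeries, GaugeDef.adRho, neg_eq_iff_eq_neg, neg_sub, PowerSeries.coeff_mul,
    lieOp_sum_left _ _ q.1.isSmoothForm, ← Finset.Nat.sum_antidiagonal_swap (n := k), 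
    ← Finset.Nat.sum_antidiagonal_swap (n := k) (f := fun ij => insertNijenhuis _ _ _),
    ← Finset.sum_sub_distrib]
  refine Finset.sum_congr rfl fun ij _ => ?_
  exact rhoHat_lieOp_commutator _ _ q.1.isSmoothForm

theorem represents_iterate_GSeries (A : PowerSeries (EndField n X)) (m : ℕ) :
    Represents (-(adEnd (rhoHatSeries A) ^ (m + 2)) (PowerSeries.C (extDOp n X p)))
      ((GaugeDef.adRho A)^[m] (GSeries A)) := by
  induction m with
  | zero => exact represents_neg_GSeries A
  | succ m ih =>
    rw [Function.iterate_succ_apply', show m + 1 + 2 = (m + 2) + 1 from rfl, pow_succ',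
      Module.End.mul_apply, ← map_neg]
    exact ih.adRho A

theorem toField_truncExp {A : PowerSeries (EndField n X)} (hA : PowerSeries.coeff 0 A = 0)
    {k K : ℕ} (hk : k ≤ K) (q : SmoothForm n X p × SmoothForm n X (p + 1)) :
    (PowerSeries.coeff k (truncExp (rhoHatSeries A) K) q).1.toField =
      gaugeAction (expSeries A) k q.1.toField := by
  rw [gaugeAction_expSeries hA hk, truncExp, map_sum, LinearMap.sum_apply, Prod.fst_sum,
    map_sum SmoothForm.toField]
  refine Finset.sum_congr rfl fun m _ => ?_
  rw [PowerSeries.coeff_smul, LinearMap.smul_apply, Prod.smul_fst, map_smul,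
    coeff_rhoHatSeries_pow]

theorem rhoHatPow_one (A : PowerSeries (EndField n X)) (k : ℕ) (η : FormField n X p) :
    rhoHatPow A 1 k η = rhoHat (PowerSeries.coeff k A) η := by
  change ∑ ij ∈ antidiagonal k, rhoHat (PowerSeries.coeff ij.1 A) (if ij.2 = 0 then η else 0) = _
  rw [Finset.sum_eq_single (k, 0)]
  · rfl
  · rintro ⟨i, j⟩ hij hne
    rw [mem_antidiagonal] at hij
    have hj : j ≠ 0 := by
      rintro rfl
      exact hne (Prod.ext hij rfl)
    rw [if_neg hj, rhoHat_zero]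
  · intro hn
    exact absurd (mem_antidiagonal.2 (add_zero k)) hn

theorem sum_range_succ_eq_add_add_sum_Icc {M : Type*} [AddCommMonoid M] {k : ℕ} (hk : 1 ≤ k)
    (f : ℕ → M) : ∑ m ∈ Finset.range (k + 1), f m = f 0 + (f 1 + ∑ m ∈ Finset.Icc 2 k, f m) := by
  rw [Finset.range_eq_Ico, Finset.sum_eq_sum_Ico_succ_bot (by omega),
    Finset.sum_eq_sum_Ico_succ_bot (by omega)]
  rfl

/-- The differential of the `k`-th coefficient of `ρ_{exp A} η`. -/
theorem extD_gaugeAction {A : PowerSeries (EndField n X)} (hA : PowerSeries.coeff 0 A = 0)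
    {η : FormField n X p} (hη : IsSmoothForm η) {k : ℕ} (hk : 1 ≤ k) :
    extD (gaugeAction (expSeries A) k η) =
      extD (rhoHat (PowerSeries.coeff k A) η) + obstruction A k η := by
  rw [gaugeAction_expSeries hA le_rfl,
    extD_sum fun m _ => (hη.rhoHatPow A m k).const_smul _]
  simp only [extD_smul]
  rw [sum_range_succ_eq_add_add_sum_Icc hk, rhoHatPow_one]
  have h0 : rhoHatPow A 0 k η = 0 := if_neg (by omega)
  rw [h0, extD_zero, smul_zero, zero_add, Nat.factorial_one, Nat.cast_one, inv_one, one_smul]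
  rfl

/-- If the coefficients of `ρ_{exp A} η` of degree less than `k` are closed, then the
obstruction in degree `k` is a combination of iterated commutators. -/
theorem obstruction_eq_sum {A : PowerSeries (EndField n X)} (hA : PowerSeries.coeff 0 A = 0)
    {η : FormField n X p} (hη : IsSmoothForm η) (hcl : extD η = 0) {k : ℕ} (hk : 1 ≤ k)
    (hprev : ∀ j, 1 ≤ j → j < k → extD (gaugeAction (expSeries A) j η) = 0) :
    obstruction A k η = ∑ m ∈ Finset.Icc 2 k, ((-1 : ℝ) ^ (m - 1) / (m.factorial : ℝ)) •
        ((GaugeDef.adRho A)^[m - 2] (GSeries A)) k η := by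
  set v : SmoothForm n X p × SmoothForm n X (p + 1) := (hη.toSmoothForm, 0) with hv
  have hr := coeff_zero_rhoHatSeries (p := p) hA
  have hd {j : ℕ} (hj : j ≤ k) :
      (extDOp n X p • PowerSeries.coeff j (truncExp (rhoHatSeries (p := p) A) k) • v).2.toField =
        extD (gaugeAction (expSeries A) j η) :=
    congrArg extD (toField_truncExp hA hj v)
  have hvan : ∀ j < k,
      extDOp n X p • PowerSeries.coeff j (truncExp (rhoHatSeries (p := p) A) k) • v = 0 := by
    intro j hj
    refine Prod.ext rfl (SmoothForm.ext ((hd hj.le).trans ?_))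
    rcases Nat.eq_zero_or_pos j with rfl | h0
    · rw [gaugeAction_expSeries hA le_rfl]
      simp [rhoHatPow, hcl]
    · exact hprev j h0 hj
  have key := congrArg (fun q => q.2.toField)
    (truncExpAd_smul_eq hr (extDOp n X p) le_rfl v hvan)
  rw [hd le_rfl, extD_gaugeAction hA hη hk, truncExpAd, map_sum, Finset.sum_smul, Prod.snd_sum,
    map_sum SmoothForm.toField, sum_range_succ_eq_add_add_sum_Icc hk] at key
  -- The term of order 0 is the constant series `d`, without a coefficient in degree `k ≥ 1`.
  have h0 : (PowerSeries.coeff k (((0 : ℕ).factorial : ℝ)⁻¹ •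
      ((-adEnd (rhoHatSeries A)) ^ 0) (PowerSeries.C (extDOp n X p))) • v).2.toField = 0 := by
    rw [pow_zero, Module.End.one_apply, PowerSeries.coeff_smul, PowerSeries.coeff_C,
      if_neg (by omega), smul_zero, zero_smul]
    rfl
  -- The term of order 1 is `-[ρ̂_A, d] η = d ρ̂_A η` since `η` is closed; it cancels against the
  -- linear term of `d e^r η`.
  have h1 : (PowerSeries.coeff k (((1 : ℕ).factorial : ℝ)⁻¹ •
      ((-adEnd (rhoHatSeries A)) ^ 1) (PowerSeries.C (extDOp n X p))) • v).2.toField =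
      extD (rhoHat (PowerSeries.coeff k A) η) := by
    rw [pow_one, Nat.factorial_one, Nat.cast_one, inv_one, one_smul, LinearMap.neg_apply, map_neg,
      neg_smul, Prod.snd_neg, map_neg SmoothForm.toField]
    have := represents_lieOp (p := p) A k v
    refine (congrArg Neg.neg this).trans ?_
    change -(rhoHat _ (extD η) - extD (rhoHat _ η)) = _
    rw [hcl, rhoHat_zero, zero_sub, neg_neg]
  rw [h0, h1, zero_add, add_right_inj] at key
  rw [← key]
  refine Finset.sum_congr rfl fun m hm => ?_
  obtain ⟨l, rfl⟩ := Nat.exists_eq_add_of_le' (Finset.mem_Icc.1 hm).1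
  have := represents_iterate_GSeries (p := p) A l k v
  rw [Nat.add_sub_cancel, show l + 2 - 1 = l + 1 by omega]
  change _ = _ • ((GaugeDef.adRho A)^[l] (GSeries A)) k v.1.toField
  rw [← this, PowerSeries.coeff_smul, smul_assoc, Prod.smul_snd, map_smul SmoothForm.toField,
    div_eq_inv_mul, mul_smul]
  congr 1
  rw [neg_adEnd_pow_apply, map_neg, LinearMap.neg_apply, Prod.snd_neg, map_neg SmoothForm.toField,
    PowerSeries.coeff_smul, smul_assoc, Prod.smul_snd, map_smul SmoothForm.toField, smul_neg,
    ← neg_smul]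
  congr 1
  ring

end OperatorSeries

/-! ### Orders of vanishing, and independence of `a_k` -/

section Truncation
variable {n : ℕ} {X : Type*} [TopologicalSpace X] [ChartedSpace (Model n) X]
  [IsManifold (𝓡 n) ∞ X] {p : ℕ}

/-- The series is, up to sign, `ad_r^{m+2} d`, and every commutator with `r` raises the order by at
least one. This makes the sum defining `fAdG` finite. -/
theorem iterate_adRho_GSeries_eq_zero {A : PowerSeries (EndField n X)}
    (hA : PowerSeries.coeff 0 A = 0) {η : FormField n X p} (hη : IsSmoothForm η) {m k : ℕ}
    (hk : k < m + 2) : ((adRho A)^[m] (GSeries A)) k η = 0 := by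
  have h := represents_iterate_GSeries (p := p) A m k (hη.toSmoothForm, 0)
  have h0 := coeff_adEnd_pow_eq_zero (coeff_zero_rhoHatSeries (p := p) hA)
    (PowerSeries.C (extDOp n X p)) (m + 2) k hk
  rw [neg_adEnd_pow_apply, PowerSeries.coeff_smul,
    smul_eq_zero_iff_right (pow_ne_zero _ (neg_ne_zero.2 one_ne_zero))] at h0
  rw [map_neg, h0, neg_zero] at h
  exact h.symm

/-- The finite form of `f(Ad) G(A, A)`. -/
theorem fAdG_eq_sum {A : PowerSeries (EndField n X)} (hA : PowerSeries.coeff 0 A = 0)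
    {η : FormField n X p} (hη : IsSmoothForm η) (k : ℕ) :
    fAdG A k η = ∑ m ∈ Finset.Icc 2 k, ((-1 : ℝ) ^ (m - 1) / (m.factorial : ℝ)) •
        ((adRho A)^[m - 2] (GSeries A)) k η := by
  rw [fAdG, finsum_eq_sum_of_support_subset (s := Finset.range (k + 1 - 2)),
    ← Finset.Ico_add_one_right_eq_Icc, Finset.sum_Ico_eq_sum_range]
  · refine Finset.sum_congr rfl fun m _ => ?_
    rw [fSeries, PowerSeries.coeff_mk, Nat.add_sub_cancel_left, Nat.add_comm 2 m,
      show m + 2 - 1 = m + 1 by omega]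
  · intro m hm
    rw [Finset.coe_range, Set.mem_Iio]
    by_contra hlt
    exact hm (by simp only; rw [iterate_adRho_GSeries_eq_zero hA hη (by omega), smul_zero])

theorem rhoHatPow_congr {A B : PowerSeries (EndField n X)} {k : ℕ}
    (h : ∀ j < k, PowerSeries.coeff j A = PowerSeries.coeff j B) (η : FormField n X p) (m : ℕ) :
    ∀ j < k, rhoHatPow A m j η = rhoHatPow B m j η := by
  induction m with
  | zero => intro j _; rfl
  | succ m ih =>
    intro j hj
    refine Finset.sum_congr rfl fun il hil => ?_
    rw [mem_antidiagonal] at hil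
    rw [h _ (by omega), ih _ (by omega)]

/-- With at least two factors, each of positive order, no single factor can contribute its
coefficient of degree `k`. -/
theorem rhoHatPow_congr_of_two_le {A B : PowerSeries (EndField n X)} {k : ℕ}
    (hA : PowerSeries.coeff 0 A = 0) (hB : PowerSeries.coeff 0 B = 0)
    (h : ∀ j < k, PowerSeries.coeff j A = PowerSeries.coeff j B) (η : FormField n X p) {m : ℕ}
    (hm : 2 ≤ m) : rhoHatPow A m k η = rhoHatPow B m k η := by
  obtain ⟨l, rfl⟩ := Nat.exists_eq_add_of_le' hm
  refine Finset.sum_congr rfl fun ij hij => ?_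
  rw [mem_antidiagonal] at hij
  rcases Nat.eq_zero_or_pos ij.1 with h0 | h0
  · rw [h0, hA, hB, rhoHat_zero_left, rhoHat_zero_left]
  · rcases Nat.eq_zero_or_pos ij.2 with h1 | h1
    · rw [h1, rhoHatPow_eq_zero hA _ (by omega), rhoHatPow_eq_zero hB _ (by omega), rhoHat_zero,
        rhoHat_zero]
    · rw [h _ (by omega), rhoHatPow_congr h η _ _ (by omega)]

theorem obstruction_congr {A B : PowerSeries (EndField n X)} {k : ℕ}
    (hA : PowerSeries.coeff 0 A = 0) (hB : PowerSeries.coeff 0 B = 0)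
    (h : ∀ j < k, PowerSeries.coeff j A = PowerSeries.coeff j B) (η : FormField n X p) :
    obstruction A k η = obstruction B k η :=
  Finset.sum_congr rfl fun m hm => by
    rw [rhoHatPow_congr_of_two_le hA hB h η (Finset.mem_Icc.1 hm).1]

theorem gaugeAction_expSeries_congr {A B : PowerSeries (EndField n X)} {k : ℕ}
    (hA : PowerSeries.coeff 0 A = 0) (hB : PowerSeries.coeff 0 B = 0)
    (h : ∀ j < k, PowerSeries.coeff j A = PowerSeries.coeff j B) (η : FormField n X p) {j : ℕ}
    (hj : j < k) : gaugeAction (expSeries A) j η = gaugeAction (expSeries B) j η := by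
  rw [gaugeAction_expSeries hA le_rfl, gaugeAction_expSeries hB le_rfl]
  exact Finset.sum_congr rfl fun m _ => by rw [rhoHatPow_congr h η m j hj]

theorem coeff_zero_gaugeSeries (a : ℕ → EndField n X) :
    PowerSeries.coeff 0 (gaugeSeries a) = 0 := by
  rw [gaugeSeries, PowerSeries.coeff_mk, if_pos rfl]

theorem coeff_gaugeSeries (a : ℕ → EndField n X) {k : ℕ} (hk : 1 ≤ k) :
    PowerSeries.coeff k (gaugeSeries a) = (k.factorial : ℝ)⁻¹ • a k := by
  rw [gaugeSeries, PowerSeries.coeff_mk, if_neg (by omega)]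

theorem coeff_gaugeSeriesLT (a : ℕ → EndField n X) {j k : ℕ} (hj : j < k) :
    PowerSeries.coeff j (gaugeSeriesLT a k) = PowerSeries.coeff j (gaugeSeries a) := by
  rw [gaugeSeriesLT, gaugeSeries, gaugeSeries, PowerSeries.coeff_mk, PowerSeries.coeff_mk,
    if_pos hj]

end Truncation

/-! ### The obstruction takes values in `E²` -/

section SectionE2
variable {n : ℕ} {X : Type*} [TopologicalSpace X] [ChartedSpace (Model n) X]
  [IsManifold (𝓡 n) ∞ X]

theorem lieOp_neg_left (b : EndField n X) {p : ℕ} {η : FormField n X p} (hη : IsSmoothForm η) :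
    lieOp (-b) η = -lieOp b η := by
  rw [eq_neg_iff_add_eq_zero, ← lieOp_add_left _ _ hη, neg_add_cancel, lieOp_zero_left]

/-- The iterated commutators of `ρ̂_A` with `G(A, A)` are sums of an algebraic operator, given by a
section of `⋀² ⊗ T`, and an operator `L_b`, in all degrees at once. -/
theorem exists_iterate_adRho_GSeries_eq (A : PowerSeries (EndField n X)) (m : ℕ) : ∀ k,
    ∃ (M : X → Model n →L[ℝ] Model n →L[ℝ] Model n) (b : EndField n X),
      ∀ (p : ℕ) (η : FormField n X p), IsSmoothForm η → ∀ x,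
        ((adRho A)^[m] (GSeries A)) k η x = altAction (M x) (η x) + lieOp b η x := by
  induction m with
  | zero =>
    intro k
    refine ⟨fun x => ∑ ij ∈ antidiagonal k, commutatorTensor
      ((PowerSeries.coeff ij.1 A).val x) ((PowerSeries.coeff ij.2 A).val x)
      (chartEndDeriv (PowerSeries.coeff ij.1 A) x) (chartEndDeriv (PowerSeries.coeff ij.2 A) x),
      -PowerSeries.coeff k (A * A), fun p η hη x => ?_⟩
    rw [Function.iterate_zero_apply, GSeries, lieOp_neg_left _ hη, altAction_sum_left, Pi.sub_apply,
      Finset.sum_apply, sub_eq_add_neg]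
    simp only [insertNijenhuis_apply]
    rfl
  | succ m ih =>
    choose M b h using ih
    intro k
    -- The new tensor collects `[ρ̂_a, altAction M]` and the part `-i_{N(a,b)}` of `[ρ̂_a, L_b]`;
    -- the part `L_{ba}` gives the new field.
    refine ⟨fun x => ∑ ij ∈ antidiagonal k,
      ((M ij.2 x ∘L (PowerSeries.coeff ij.1 A).val x +
        ((ContinuousLinearMap.compL ℝ (Model n) (Model n) (Model n)).flip
          ((PowerSeries.coeff ij.1 A).val x) ∘L M ij.2 x -
        ContinuousLinearMap.compL ℝ (Model n) (Model n) (Model n)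
          ((PowerSeries.coeff ij.1 A).val x) ∘L M ij.2 x)) -
      commutatorTensor ((PowerSeries.coeff ij.1 A).val x) ((b ij.2).val x)
        (chartEndDeriv (PowerSeries.coeff ij.1 A) x) (chartEndDeriv (b ij.2) x)),
      ∑ ij ∈ antidiagonal k, b ij.2 * PowerSeries.coeff ij.1 A, fun p η hη x => ?_⟩
    rw [Function.iterate_succ_apply', adRho, Finset.sum_apply, altAction_sum_left,
      lieOp_sum_left _ _ hη, Finset.sum_apply, ← Finset.sum_add_distrib]
    refine Finset.sum_congr rfl fun ij _ => ?_
    have h1 := congrFun (rhoHat_lieOp_commutator (PowerSeries.coeff ij.1 A) (b ij.2) hη) x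
    have h2 := infAction_altAction_commutator ((PowerSeries.coeff ij.1 A).val x) (M ij.2 x) (η x)
    rw [altAction_sub_left, ← insertNijenhuis_apply, ← h2]
    rw [Pi.sub_apply, Pi.sub_apply] at h1
    rw [Pi.sub_apply, h _ _ _ (hη.rhoHat _)]
    change infAction _ (((adRho A)^[m] (GSeries A)) ij.2 η x) - _ = _
    rw [h _ _ _ hη, infAction_add]
    change _ + rhoHat _ (lieOp (b ij.2) η) x - _ = _
    rw [eq_add_of_sub_eq h1, rhoHat]
    abel

variable {V : Type*} [NormedAddCommGroup V] [NormedSpace ℝ V] {l : ℕ}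
  {p : Fin l → ℕ} {ΦV : ∀ i, V [⋀^Fin (p i)]→L[ℝ] ℝ} {Φ : ∀ i, FormField n X (p i)}

theorem IsOrbitSection.iterate_adRho_GSeries_mem_E2 (hΦ : IsOrbitSection ΦV Φ)
    (A : PowerSeries (EndField n X)) (m k : ℕ) (x : X) :
    (fun i => ((adRho A)^[m] (GSeries A)) k (Φ i) x) ∈ E2 fun i => Φ i x := by
  obtain ⟨M, b, h⟩ := exists_iterate_adRho_GSeries_eq A m k
  obtain ⟨M', h'⟩ := hΦ.exists_lieOp_eq b x
  convert altAction_mem_E2 (fun i => Φ i x) (M x + M') using 1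
  funext i
  rw [h _ _ (hΦ.1 i), h', altAction_add_left]

theorem IsSmoothForm.obstruction {q : ℕ} {η : FormField n X q} (hη : IsSmoothForm η)
    (A : PowerSeries (EndField n X)) (k : ℕ) : IsSmoothForm (obstruction A k η) :=
  IsSmoothForm.sum fun m _ => (hη.rhoHatPow A m k).extD.const_smul _

end SectionE2

/-- The exponential series of `-x` without its first two terms, divided by `-x²`. -/
theorem hasSum_fSeries {x : ℝ} (hx : x ≠ 0) :
    HasSum (fun m => PowerSeries.coeff m fSeries * x ^ m)
      (-(Real.exp (-x) - 1 + x) / x ^ 2) := by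
  have h := NormedSpace.expSeries_div_hasSum_exp (-x)
  rw [← Real.exp_eq_exp_ℝ, ← hasSum_nat_add_iff' 2] at h
  have h' := h.mul_right (-(x ^ 2)⁻¹)
  have hs : (Real.exp (-x) - ∑ i ∈ Finset.range 2, (-x) ^ i / (i.factorial : ℝ)) * -(x ^ 2)⁻¹ =
      -(Real.exp (-x) - 1 + x) / x ^ 2 := by
    simp only [Finset.sum_range_succ, Finset.sum_range_zero, pow_zero, pow_one, Nat.factorial_zero,
      Nat.factorial_one, Nat.cast_one]
    field_simp
    ring
  rw [hs] at h'
  refine (funext fun m => ?_ : (fun m => PowerSeries.coeff m fSeries * x ^ m) = _) ▸ h'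
  rw [fSeries, PowerSeries.coeff_mk, neg_pow x]
  field_simp
  ring

end GaugeDef
end

/-! ### The main theorem -/

theorem mainTheorem3 {n : ℕ} {X : Type*} [TopologicalSpace X]
    [ChartedSpace (EuclideanSpace ℝ (Fin n)) X] [IsManifold (𝓡 n) ∞ X] [CompactSpace X] [T2Space X]
    {V : Type*} [NormedAddCommGroup V] [NormedSpace ℝ V] [FiniteDimensional ℝ V]
    (_hV : Module.finrank ℝ V = n)
    {l : ℕ} {p : Fin l → ℕ} (ΦV : ∀ i, V [⋀^Fin (p i)]→L[ℝ] ℝ)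
    (Φ : ∀ i, FormField n X (p i)) (hΦ : IsOrbitSection ΦV Φ) (hclosed : ∀ i, extD (Φ i) = 0)
    (a : ℕ → EndField n X) (k : ℕ) (hk : 1 ≤ k)
    (hprev : ∀ j, 1 ≤ j → j < k →
      ∀ i, extD (gaugeAction (expSeries (gaugeSeries a)) j (Φ i)) = 0) :
    (∀ i, extD (gaugeAction (expSeries (gaugeSeries a)) k (Φ i)) =
      (k.factorial : ℝ)⁻¹ • extD (rhoHat (a k) (Φ i)) +
        obstruction (gaugeSeriesLT a k) k (Φ i)) ∧
    (∀ i, obstruction (gaugeSeriesLT a k) k (Φ i) =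
      ∑ m ∈ Finset.Icc 2 k, ((-1 : ℝ) ^ (m - 1) / (m.factorial : ℝ)) •
        ((adRho (gaugeSeries a))^[m - 2] (GSeries (gaugeSeries a))) k (Φ i)) ∧
    (∀ i, obstruction (gaugeSeriesLT a k) k (Φ i) = fAdG (gaugeSeries a) k (Φ i)) ∧
    (∀ i, obstruction (gaugeSeriesLT a k) k (Φ i) = fAdG (gaugeSeriesLT a k) k (Φ i)) ∧
    (∀ x : ℝ, x ≠ 0 → HasSum (fun m => PowerSeries.coeff m fSeries * x ^ m)
      (-(Real.exp (-x) - 1 + x) / x ^ 2)) ∧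
    IsSectionE2 Φ (fun i => obstruction (gaugeSeriesLT a k) k (Φ i)) ∧
    (∃ β : ∀ i, FormField n X (p i), (∀ i, IsSmoothForm (β i)) ∧
      ∀ i, obstruction (gaugeSeriesLT a k) k (Φ i) = extD (β i)) := by
  have h0 := coeff_zero_gaugeSeries a
  have h0' : PowerSeries.coeff 0 (gaugeSeriesLT a k) = 0 := coeff_zero_gaugeSeries _
  have hlt : ∀ j < k, PowerSeries.coeff j (gaugeSeriesLT a k) =
      PowerSeries.coeff j (gaugeSeries a) := fun j hj => coeff_gaugeSeriesLT a hj
  have hob (i : Fin l) : obstruction (gaugeSeriesLT a k) k (Φ i) =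
      obstruction (gaugeSeries a) k (Φ i) := obstruction_congr h0' h0 hlt _
  have hsum (i : Fin l) := (hob i).trans
    (obstruction_eq_sum h0 (hΦ.1 i) (hclosed i) hk fun j hj hjk => hprev j hj hjk i)
  refine ⟨fun i => ?_, hsum, fun i => ?_, fun i => ?_, fun x hx => hasSum_fSeries hx,
    ⟨fun i => (hΦ.1 i).obstruction _ _, fun x => ?_⟩, ?_⟩
  · rw [extD_gaugeAction h0 (hΦ.1 i) hk, hob, coeff_gaugeSeries a hk, rhoHat_smul_left, extD_smul]
  · rw [hsum, fAdG_eq_sum h0 (hΦ.1 i)]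
  · rw [fAdG_eq_sum h0' (hΦ.1 i)]
    refine obstruction_eq_sum h0' (hΦ.1 i) (hclosed i) hk fun j hj hjk => ?_
    -- The coefficients of degree below `k` do not see `a_k`, so the hypothesis on lower
    -- coefficients passes to the truncated series.
    rw [gaugeAction_expSeries_congr h0' h0 hlt _ hjk]
    exact hprev j hj hjk i
  · have h : (fun i => obstruction (gaugeSeriesLT a k) k (Φ i) x) =
        ∑ m ∈ Finset.Icc 2 k, ((-1 : ℝ) ^ (m - 1) / (m.factorial : ℝ)) • fun i =>
          ((adRho (gaugeSeries a))^[m - 2] (GSeries (gaugeSeries a))) k (Φ i) x := by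
      funext i
      rw [hsum, Finset.sum_apply, Finset.sum_apply]
      rfl
    rw [h]
    exact Submodule.sum_mem _ fun m _ =>
      Submodule.smul_mem _ _ (hΦ.iterate_adRho_GSeries_mem_E2 _ _ _ x)
  -- The primitive is the defining sum of the obstruction with `d` taken out.
  · refine ⟨fun i => ∑ m ∈ Finset.Icc 2 k,
      (m.factorial : ℝ)⁻¹ • rhoHatPow (gaugeSeriesLT a k) m k (Φ i), fun i => ?_, fun i => ?_⟩
    · exact IsSmoothForm.sum fun m _ => ((hΦ.1 i).rhoHatPow _ m k).const_smul _
    · rw [extD_sum fun m _ => ((hΦ.1 i).rhoHatPow _ m k).const_smul _]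
      simp only [extD_smul]
      rfl
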